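/- **Setting.** For $\mathcal C\in\mathbb C^{m\times m\times p}$ with frontal slices $\mathbf C^{(1)},\dots,\mathbf C^{(p)}$, let $\mathrm{bcirc}(\mathcal C)\in\mathbb C^{mp\times mp}$ be the block circulant matrix whose block $(i,j)$ is $\mathbf C^{(i-j+1)}$ (slice index modulo $p$). The T-product is $\mathcal C\star\mathcal D=\mathrm{fold}(\mathrm{bcirc}(\mathcal C)\cdot\mathrm{unfold}(\mathcal D))$, where $\mathrm{unfold}$ stacks the frontal slices and $\mathrm{fold}$ is its inverse; it is defined in the same way for $\mathcal D\in\mathbb C^{m\times 1\times p}$. Put $\mathcal C^{\mathrm H}=\mathrm{bcirc}^{-1}(\mathrm{bcirc}(\mathcal C)^{\mathrm H})$ and $\mathcal I=\mathrm{bcirc}^{-1}(I_{mp})$. A tensor $\mathcal U$ is unitary if $\mathcal U^{\mathrm H}\star\mathcal U=\mathcal U\star\mathcal U^{\mathrm H}=\mathcal I$. A real tensor $\mathcal C\in\mathbb R^{m\times m\times p}$ is T-positive definite (TPD) if $\mathcal C^{\mathrm H}=\mathcal C$ and $\langle\mathcal X,\mathcal C\star\mathcal X\rangle>0$ for all nonzero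 $\mathcal X\in\mathbb R^{m\times1\times p}$, where $\langle\cdot,\cdot\rangle$ is the entrywise inner product. Functions of Hermitian tensors (such as $\log\mathcal C$) are defined by the spectral functional calculus, i.e. $\mathrm{bcirc}(f(\mathcal C))=f(\mathrm{bcirc}(\mathcal C))$; likewise $\mathrm{bcirc}(\exp\mathcal C)=\exp(\mathrm{bcirc}(\mathcal C))$ for every $\mathcal C$. Further, $\mathcal C^{z}=\exp(z\log\mathcal C)$ for TPD $\mathcal C$ and $z\in\mathbb C$, and $|\mathcal C|=\sqrt{\mathcal C^{\mathrm H}\star\mathcal C}$. A norm $\|\cdot\|_\rho$ on $\mathbb C^{m\times m\times p}$ is unitarily invariant if $\|\mathcal H\star\mathcal U\|_\rho=\|\mathcal U\star\mathcal H\|_\rho=\|\mathcal H\|_\rho$ for all $\mathcal H$ and all unitary $\mathcal U$. **Theorem.** Let $\mathcal C_1,\dots,\mathcal C_n\in\mathbb R^{m\times m\times p}$ be TPD tensors, let $\|\cdot\|_\rho$ be a unitarily invariant norm on $\mathbb C^{m\times m\times p}$, and let $\beta_0(t)=\dfrac{\pi}{2(\cosh(\pi t)+1)}$. The products below are T-products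 taken in the order $\mathcal C_1^{1+\iota t}\star\cdots\star\mathcal C_n^{1+\iota t}$, with $\iota^2=-1$. 1. For every continuous $f:(0,\infty)\to[0,\infty)$ such that $x\mapsto\log f(e^x)$ is convex on $\mathbb R$ (with the conventions $\log0=-\infty$ and $e^{-\infty}=0$), $$\Big\|f\Big(\exp\Big(\sum_{i=1}^n\log\mathcal C_i\Big)\Big)\Big\|_\rho\le\exp\int_{-\infty}^{\infty}\log\Big\|f\Big(\Big|\prod_{i=1}^n\mathcal C_i^{1+\iota t}\Big|\Big)\Big\|_\rho\,\beta_0(t)\,dt ,$$ and the integrand is integrable unless the norm inside the logarithm vanishes identically in $t$, in which case the left-hand side is $0$. 2. For every continuous $g:(0,\infty)\to[0,\infty)$ such that $x\mapsto g(e^x)$ is convex on $\mathbb R$, $$\Big\|g\Big(\exp\Big(\sum_{i=1}^n\log\mathcal C_i\Big)\Big)\Big\|_\rho\le\int_{-\infty}^{\infty}\Big\|g\Big(\Big|\prod_{i=1}^n\mathcal C_i^{1+\iota t}\Big|\Big)\Big\|_\rho\,\beta_0(t)\,dt ,$$ and the integrand is integrable. -/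

import Mathlib

/-!
Third-order tensors of size `m × n × p` under the T-product. Frontal slices are indexed
cyclically by `Fin p` (arithmetic on `Fin p` is modulo `p`); slice `k` here is the slice
usually numbered `k + 1`.
-/

namespace TProd

/-- Tensors in `R^{m × n × p}`, given by their `p` frontal slices. Addition and scalar
multiplication are entrywise. -/
abbrev Tensor (R : Type*) (m n p : ℕ) := Fin p → Matrix (Fin m) (Fin n) R

section Algebra

variable {R : Type*} {m n l p : ℕ}

/-- The block circulant matrix of a tensor: block `(i, j)` is the slice `i - j` modulo `p`. -/
def bcirc (C : Tensor R m n p) : Matrix (Fin p × Fin m) (Fin p × Fin n) R :=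
  Matrix.of fun x y => C (x.1 - y.1) x.2 y.2

/-- The inverse of `bcirc`: read the slices off the first block column. -/
def bcircInv [NeZero p] (M : Matrix (Fin p × Fin m) (Fin p × Fin n) R) : Tensor R m n p :=
  fun k => Matrix.of fun a b => M (k, a) (0, b)

theorem bcircInv_bcirc [NeZero p] (C : Tensor R m n p) : bcircInv (bcirc C) = C := by
  ext k a b
  simp [bcircInv, bcirc]

/-- Stack the frontal slices on top of each other. -/
def unfold (C : Tensor R m n p) : Matrix (Fin p × Fin m) (Fin n) R :=
  Matrix.of fun x b => C x.1 x.2 b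

/-- The inverse of `unfold`. -/
def fold (M : Matrix (Fin p × Fin m) (Fin n) R) : Tensor R m n p :=
  fun k => Matrix.of fun a b => M (k, a) b

/-- The T-product `C ⋆ D = fold (bcirc C · unfold D)`. -/
def tmul [NonUnitalNonAssocSemiring R] (C : Tensor R m n p) (D : Tensor R n l p) :
    Tensor R m l p :=
  fold (bcirc C * unfold D)

/-- The identity tensor. -/
def tone [NeZero p] [Zero R] [One R] : Tensor R m m p := bcircInv 1

/-- The Hermitian transpose of a tensor (the transpose, over the reals). -/
def tconj [NeZero p] [Star R] (C : Tensor R m n p) : Tensor R n m p :=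
  bcircInv (bcirc C).conjTranspose

/-- The inner product `∑ c_{ijk}^* d_{ijk}`. -/
def tinner [NonUnitalNonAssocSemiring R] [Star R] (C D : Tensor R m n p) : R :=
  ∑ k, ∑ i, ∑ j, star (C k i j) * D k i j

/-- Products `C_1 ⋆ C_2 ⋆ ⋯ ⋆ C_N`, in this order. -/
def tprod [NeZero p] [NonAssocSemiring R] {N : ℕ} (C : Fin N → Tensor R m m p) :
    Tensor R m m p :=
  (List.ofFn C).foldr tmul tone

end Algebra

section Predicates

variable {m p : ℕ} [NeZero p]

/-- T-positive definite real tensors: symmetric, with `⟨X, C ⋆ X⟩ > 0` for every nonzero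
`X ∈ ℝ^{m × 1 × p}`. -/
def IsTPD (C : Tensor ℝ m m p) : Prop :=
  tconj C = C ∧ ∀ X : Tensor ℝ m 1 p, X ≠ 0 → 0 < tinner X (tmul C X)

/-- Unitary tensors. -/
def IsUnitary (U : Tensor ℂ m m p) : Prop :=
  tmul (tconj U) U = tone ∧ tmul U (tconj U) = tone

end Predicates

/-- Unitarily invariant norms on `ℂ^{m × m × p}`. -/
structure UnitarilyInvariantNorm (m p : ℕ) [NeZero p] extends Seminorm ℂ (Tensor ℂ m m p) where
  eq_zero_of_map_eq_zero' : ∀ H, toFun H = 0 → H = 0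
  map_mul_unitary' : ∀ H U, IsUnitary U → toFun (tmul H U) = toFun H
  map_unitary_mul' : ∀ H U, IsUnitary U → toFun (tmul U H) = toFun H

noncomputable instance (m p : ℕ) [NeZero p] :
    CoeFun (UnitarilyInvariantNorm m p) (fun _ => Tensor ℂ m m p → ℝ) :=
  ⟨fun N => N.toSeminorm⟩

section Functions

variable {m p : ℕ}

/-- A real tensor, seen as a complex one. -/
def toComplex (C : Tensor ℝ m m p) : Tensor ℂ m m p :=
  fun k => (C k).map Complex.ofReal

variable [NeZero p]

/-- The function `f (C)` of a Hermitian tensor `C`: `f` is applied to the T-eigenvalues in the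
spectral decomposition, that is, `bcirc (f (C)) = f (bcirc C)` (see `bcirc_tfun`). -/
noncomputable def tfun (f : ℝ → ℝ) (C : Tensor ℂ m m p) : Tensor ℂ m m p :=
  bcircInv (cfc f (bcirc C))

/-- The exponential of a tensor, `bcirc (exp C) = exp (bcirc C)` (see `bcirc_texp`). -/
noncomputable def texp (C : Tensor ℂ m m p) : Tensor ℂ m m p :=
  bcircInv (NormedSpace.exp (bcirc C))

/-- The logarithm of a tensor with positive T-eigenvalues. -/
noncomputable def tlog (C : Tensor ℂ m m p) : Tensor ℂ m m p := tfun Real.log C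

/-- The complex power `C ^ z = exp (z log C)` of a tensor with positive T-eigenvalues. -/
noncomputable def tcpow (C : Tensor ℂ m m p) (z : ℂ) : Tensor ℂ m m p := texp (z • tlog C)

/-- The absolute value `|C| = √(Cᴴ ⋆ C)`. -/
noncomputable def tabs (C : Tensor ℂ m m p) : Tensor ℂ m m p :=
  tfun Real.sqrt (tmul (tconj C) C)

/-- The shift of the block indices by `s`. -/
def shiftMatrix (m p : ℕ) [NeZero p] (s : Fin p) : Matrix (Fin p × Fin m) (Fin p × Fin m) ℂ :=
  Matrix.of fun x y => if (x.1 + s, x.2) = y then 1 else 0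

theorem shiftMatrix_mul_apply (s : Fin p) (M : Matrix (Fin p × Fin m) (Fin p × Fin m) ℂ)
    (x y : Fin p × Fin m) : (shiftMatrix m p s * M) x y = M (x.1 + s, x.2) y := by
  simp only [shiftMatrix, Matrix.mul_apply, Matrix.of_apply, ite_mul, one_mul, zero_mul,
    Finset.sum_ite_eq, Finset.mem_univ, if_true]

theorem mul_shiftMatrix_apply (s : Fin p) (M : Matrix (Fin p × Fin m) (Fin p × Fin m) ℂ)
    (x y : Fin p × Fin m) : (M * shiftMatrix m p s) x y = M x (y.1 - s, y.2) := by
  have h : ∀ z : Fin p × Fin m, ((z.1 + s, z.2) = y) = ((y.1 - s, y.2) = z) := by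
    intro z
    simp only [Prod.ext_iff, eq_iff_iff]
    constructor
    · rintro ⟨h1, h2⟩; exact ⟨by rw [← h1]; simp, h2.symm⟩
    · rintro ⟨h1, h2⟩; exact ⟨by rw [← h1]; simp, h2.symm⟩
  simp only [shiftMatrix, Matrix.mul_apply, Matrix.of_apply, mul_ite, mul_one, mul_zero, h,
    Finset.sum_ite_eq, Finset.mem_univ, if_true]

theorem commute_bcirc_shiftMatrix (C : Tensor ℂ m m p) (s : Fin p) :
    Commute (bcirc C) (shiftMatrix m p s) := by
  ext x y
  rw [mul_shiftMatrix_apply, shiftMatrix_mul_apply]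
  have h : x.1 - (y.1 - s) = x.1 + s - y.1 := by abel
  simp only [bcirc, Matrix.of_apply, h]

theorem bcirc_bcircInv {M : Matrix (Fin p × Fin m) (Fin p × Fin m) ℂ}
    (h : ∀ s, Commute M (shiftMatrix m p s)) : bcirc (bcircInv M) = M := by
  ext x y
  have := congrFun (congrFun (h y.1) (x.1 - y.1, x.2)) (y.1, y.2)
  rw [mul_shiftMatrix_apply, shiftMatrix_mul_apply] at this
  simpa [bcirc, bcircInv] using this

theorem bcirc_tfun (f : ℝ → ℝ) (C : Tensor ℂ m m p) : bcirc (tfun f C) = cfc f (bcirc C) :=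
  bcirc_bcircInv fun s => (commute_bcirc_shiftMatrix C s).cfc_real f

theorem bcirc_texp (C : Tensor ℂ m m p) : bcirc (texp C) = NormedSpace.exp (bcirc C) :=
  bcirc_bcircInv fun s => (commute_bcirc_shiftMatrix C s).exp_left

end Functions

/-- The density `β₀`. -/
noncomputable def beta0 (t : ℝ) : ℝ := Real.pi / (2 * (Real.cosh (Real.pi * t) + 1))

/-- The logarithm of a nonnegative number, with `log 0 = -∞`. -/
noncomputable def elog (x : ℝ) : EReal := ENNReal.log (ENNReal.ofReal x)

/-- Convexity on `ℝ` of a function with values in `[-∞, ∞)`. -/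
def IsConvexEReal (L : ℝ → EReal) : Prop :=
  ∀ x y a b : ℝ, 0 < a → 0 < b → a + b = 1 →
    L (a * x + b * y) ≤ (a : EReal) * L x + (b : EReal) * L y

/-- The Lebesgue integral over `ℝ` of an extended-real function, as the integral of the positive
part minus that of the negative part. -/
noncomputable def eintegral (F : ℝ → EReal) : EReal :=
  ((∫⁻ t, (F t).toENNReal : ENNReal) : EReal) - ((∫⁻ t, (-F t).toENNReal : ENNReal) : EReal)

end TProd

/-!
The multivariate Golden–Thompson inequality for unitarily invariant norms of tensors. The Fourier
transform along the third index turns block circulant matrices into families of matrices. For these,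
a boundary form of Hirschman's strengthening of the three lines theorem, applied to determinants of
compressions, gives a logarithmic majorization of the eigenvalues of `exp (∑ log C i)` by the
averaged singular values of the products of complex powers. The norm inequalities follow by
convexity. The tensors `C i` enter only through the Hermitian tensors `log C i`.
-/

/-! ### Subharmonicity of `log ‖g‖` on the disc, up to radial boundary values. -/

namespace TProd

open Filter Topology MeasureTheory Metric

/-! The characters of `Fin p` identify `M_m(ℂ)^p` with the block circulant matrices by an injective
star homomorphism (`blockCirculantHom`). T-product, adjoint, exponential and functional calculus
become blockwise operations, and the norm becomes one that is invariant under unitaries in each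
block. On a function of Hermitian blocks such a norm is a gauge function of the eigenvalues,
monotone on nonnegative families and symmetric under independent permutations within the blocks.

In one block, let `A_i` be the Hermitian logarithms, `H = ∑ A_i`, `F(z) = ∏ exp(z A_i)`, and let the
columns of `V` be eigenvectors for the `j` largest eigenvalues of `H`. The entire function `h(z) =
det(Vᴴ F(z) V)` satisfies `h(0) = 1`, and `h'(0) = tr(Vᴴ H V)` is the sum of these eigenvalues. On
the imaginary axis `F` is unitary, so `|h| ≤ 1`; on `re z = 1`, min-max bounds `|h|` by the product
of the `j` largest singular values of `F(1 + it)`. The harmonic majorant of `log |h|` on the strip,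
evaluated at `θ`, divided by `θ` and taken to the limit `θ → 0`, has density `β₀`
(`re_deriv_le_integral_mul_beta0`). Hence the sum of the `j` largest eigenvalues of `H` is at most
the `β₀`-average of the sum of the `j` largest log singular values (`sum_sortedEig_le_integral`).
Differentiating at `0` produces `H` directly, with no Lie–Trotter limit, and the determinant of the
compression replaces exterior powers. For `j = m` equality holds at each `t`, by determinants.

So the eigenvalues of the sums `H` are majorized, block by block, by the average of the log singular
values. By Hardy–Littlewood–Pólya and Jensen, every convex function with the symmetry above obeys
the averaged inequality (`convexOn_le_integral_of_majorized`). It is applied to the gauge of `g ∘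
exp`, and to the logarithm of the gauge of `f ∘ exp`, which is convex by a Hölder argument. -/

/-- **Jensen's inequality**: the logarithm of the norm of an analytic function is subharmonic. -/
theorem log_norm_le_circleAverage {f : ℂ → ℂ} {c : ℂ} {R : ℝ} (hR : 0 < R)
    (hf : AnalyticOnNhd ℂ f (closedBall c R)) (hc : f c ≠ 0) :
    Real.log ‖f c‖ ≤ Real.circleAverage (fun z => Real.log ‖f z‖) c R := by
  have hR' : |R| = R := abs_of_pos hR
  rw [AnalyticOnNhd.circleAverage_log_norm hR.ne' (by rwa [hR']) hc]
  -- In Jensen's formula each zero `u` of `f` contributes its multiplicity times `log (R / ‖c - u‖)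
  -- ≥ 0`.
  have h : 0 ≤ ∑ᶠ u, ((MeromorphicOn.divisor f (closedBall c |R|) u : ℤ) : ℝ) *
      Real.log (R * ‖c - u‖⁻¹) := by
    refine finsum_nonneg fun u => ?_
    by_cases hu : u ∈ closedBall c |R|
    · have hf' : AnalyticOnNhd ℂ f (closedBall c |R|) := by rwa [hR']
      refine mul_nonneg (mod_cast MeromorphicOn.AnalyticOnNhd.divisor_nonneg hf' u) ?_
      rcases eq_or_ne u c with rfl | huc
      · simp
      · have hpos : 0 < ‖c - u‖ := norm_pos_iff.2 (sub_ne_zero.2 huc.symm)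
        refine Real.log_nonneg ?_
        rw [← div_eq_mul_inv, one_le_div hpos]
        rw [mem_closedBall, hR', dist_comm, dist_eq_norm] at hu
        exact hu
    · simp [hu]
  linarith

/-- The sub-mean-value property of `log ‖g‖` on the unit disc, with radial boundary values. -/
theorem log_norm_le_integral_of_radial_limit_of_nonneg {g : ℂ → ℂ} {b : ℝ → ℝ} {M K : ℝ}
    (hg : DifferentiableOn ℂ g (ball 0 1)) (hM : ∀ w ∈ ball (0 : ℂ) 1, ‖g w‖ ≤ M) (h0 : g 0 ≠ 0)
    (hb : Measurable b) (hb0 : ∀ s, 0 ≤ b s) (hbK : ∀ s, b s ≤ K)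
    (hlim : ∀ᵐ s ∂(volume.restrict (Set.uIoc 0 (2 * Real.pi))), ∃ G,
      Tendsto (fun r : ℝ => g (circleMap 0 r s)) (𝓝[<] 1) (𝓝 G) ∧ ‖G‖ ≤ Real.exp (b s)) :
    Real.log ‖g 0‖ ≤ (2 * Real.pi)⁻¹ * ∫ s in (0 : ℝ)..2 * Real.pi, b s := by
  have hmem : ∀ r : ℝ, 0 < r → r < 1 → ∀ s, circleMap 0 r s ∈ ball (0 : ℂ) 1 := by
    intro r hr hr1 s
    simpa [abs_of_pos hr] using hr1
  -- Truncating `‖g‖` from below at `exp (b s)` keeps the logarithm bounded, so dominated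
  -- convergence applies, and makes the radial limit exactly `b s`. Since `b ≥ 0`, also `φ ≥ 0`,
  -- which covers the zeros of `g`, where `Real.log 0 = 0`.
  set φ : ℝ → ℝ → ℝ := fun r s => Real.log (max ‖g (circleMap 0 r s)‖ (Real.exp (b s))) with hφ
  have hφlow : ∀ r s, 0 ≤ φ r s := fun r s =>
    Real.log_nonneg ((Real.one_le_exp (hb0 s)).trans (le_max_right _ _))
  have hφup : ∀ r, 0 < r → r < 1 → ∀ s, φ r s ≤ Real.log (max M (Real.exp K)) := by
    intro r hr hr1 s
    refine Real.log_le_log (lt_max_of_lt_right (Real.exp_pos _))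
      (max_le_max (hM _ (hmem r hr hr1 s))
      (Real.exp_le_exp.2 (hbK s)))
  set C := Real.log (max M (Real.exp K)) with hC
  have hφC : ∀ r, 0 < r → r < 1 → ∀ s, ‖φ r s‖ ≤ C := by
    intro r hr hr1 s
    rw [Real.norm_of_nonneg (hφlow r s)]
    exact hφup r hr hr1 s
  have hcont : ∀ r : ℝ, 0 < r → r < 1 → Continuous fun s => g (circleMap 0 r s) := by
    intro r hr hr1
    rw [← continuousOn_univ]
    exact hg.continuousOn.comp (continuous_circleMap 0 r).continuousOn fun s _ => hmem r hr hr1 s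
  have hφm : ∀ r, 0 < r → r < 1 → Measurable (φ r) := by
    intro r hr hr1
    exact Real.measurable_log.comp ((hcont r hr hr1).norm.measurable.max
      (Real.measurable_exp.comp hb))
  have hφi : ∀ r, 0 < r → r < 1 → IntervalIntegrable (φ r) volume 0 (2 * Real.pi) := by
    intro r hr hr1
    refine (intervalIntegrable_const (c := C)).mono_fun
      (hφm r hr hr1).aestronglyMeasurable (ae_of_all _ fun s => ?_)
    exact (hφC r hr hr1 s).trans (le_abs_self _)
  have hle : ∀ r : ℝ, 0 < r → r < 1 →
      Real.log ‖g 0‖ ≤ (2 * Real.pi)⁻¹ * ∫ s in (0 : ℝ)..2 * Real.pi, φ r s := by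
    intro r hr hr1
    have han : AnalyticOnNhd ℂ g (closedBall 0 r) :=
      (hg.analyticOnNhd isOpen_ball).mono (closedBall_subset_ball hr1)
    refine (log_norm_le_circleAverage hr han h0).trans ?_
    rw [Real.circleAverage_def, smul_eq_mul]
    have hpi := Real.pi_pos
    gcongr
    refine intervalIntegral.integral_mono (by positivity) ?_ (hφi r hr hr1) fun s => ?_
    · exact MeromorphicOn.circleIntegrable_log_norm (fun z hz =>
        (han z (by rw [abs_of_pos hr] at hz; exact sphere_subset_closedBall hz)).meromorphicAt)
    · rcases (norm_nonneg (g (circleMap 0 r s))).eq_or_lt with hz | hz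
      · simpa only [← hz, Real.log_zero] using hφlow r s
      · exact Real.log_le_log hz (le_max_left _ _)
  have hlimφ : Tendsto (fun r => (2 * Real.pi)⁻¹ * ∫ s in (0 : ℝ)..2 * Real.pi, φ r s) (𝓝[<] 1)
      (𝓝 ((2 * Real.pi)⁻¹ * ∫ s in (0 : ℝ)..2 * Real.pi, b s)) := by
    refine Tendsto.const_mul _ ?_
    have hev : ∀ᶠ r : ℝ in 𝓝[<] 1, 0 < r ∧ r < 1 :=
      Ioo_mem_nhdsLT (by norm_num : (0 : ℝ) < 1)
    refine intervalIntegral.tendsto_integral_filter_of_dominated_convergence (fun _ => C) ?_ ?_ ?_ ?_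
    · filter_upwards [hev] with r hr
      exact (hφm r hr.1 hr.2).aestronglyMeasurable
    · filter_upwards [hev] with r hr
      exact ae_of_all _ fun s _ => hφC r hr.1 hr.2 s
    · exact intervalIntegrable_const
    · have := (ae_restrict_iff' measurableSet_uIoc).1 hlim
      filter_upwards [this] with s hs hs'
      obtain ⟨G, hG, hGb⟩ := hs hs'
      have h1 : Tendsto (fun r => max ‖g (circleMap 0 r s)‖ (Real.exp (b s))) (𝓝[<] 1)
          (𝓝 (max ‖G‖ (Real.exp (b s)))) := hG.norm.max tendsto_const_nhds
      rw [max_eq_right hGb] at h1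
      have h2 := h1.log (Real.exp_pos _).ne'
      rwa [Real.log_exp] at h2
  refine ge_of_tendsto hlimφ ?_
  filter_upwards [Ioo_mem_nhdsLT (by norm_num : (0 : ℝ) < 1)] with r hr
  exact hle r hr.1 hr.2

/-- The sub-mean-value property of `log ‖g‖` on the unit disc, with radial boundary values. -/
theorem log_norm_le_integral_of_radial_limit {g : ℂ → ℂ} {b : ℝ → ℝ} {M K : ℝ}
    (hg : DifferentiableOn ℂ g (ball 0 1)) (hM : ∀ w ∈ ball (0 : ℂ) 1, ‖g w‖ ≤ M) (h0 : g 0 ≠ 0)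
    (hb : Measurable b) (hbK : ∀ s, |b s| ≤ K)
    (hlim : ∀ᵐ s ∂(volume.restrict (Set.uIoc 0 (2 * Real.pi))), ∃ G,
      Tendsto (fun r : ℝ => g (circleMap 0 r s)) (𝓝[<] 1) (𝓝 G) ∧ ‖G‖ ≤ Real.exp (b s)) :
    Real.log ‖g 0‖ ≤ (2 * Real.pi)⁻¹ * ∫ s in (0 : ℝ)..2 * Real.pi, b s := by
  have hE : ‖(Real.exp K : ℂ)‖ = Real.exp K := by
    rw [Complex.norm_real, Real.norm_of_nonneg (Real.exp_pos K).le]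
  -- Multiplying `g` by `exp K` shifts `b` to `K + b ≥ 0`; the constant cancels at the end.
  have key := log_norm_le_integral_of_radial_limit_of_nonneg (g := fun w => (Real.exp K : ℂ) * g w)
    (b := fun s => K + b s) (M := Real.exp K * M) (K := 2 * K) (hg.const_mul _)
    (fun w hw => by
      rw [norm_mul, hE]
      exact mul_le_mul_of_nonneg_left (hM w hw) (Real.exp_pos K).le)
    (mul_ne_zero (by exact_mod_cast (Real.exp_pos K).ne') h0) (hb.const_add K)
    (fun s => by linarith [(abs_le.1 (hbK s)).1]) (fun s => by linarith [(abs_le.1 (hbK s)).2])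
    (by
      filter_upwards [hlim] with s hs
      obtain ⟨G, hG, hGb⟩ := hs
      refine ⟨_, hG.const_mul _, ?_⟩
      rw [norm_mul, hE, Real.exp_add]
      exact mul_le_mul_of_nonneg_left hGb (Real.exp_pos K).le)
  have hbi : IntervalIntegrable b volume 0 (2 * Real.pi) := by
    refine (intervalIntegrable_const (c := K)).mono_fun hb.aestronglyMeasurable
      (ae_of_all _ fun s => ?_)
    exact (hbK s).trans (le_abs_self _)
  rw [norm_mul, hE, Real.log_mul (Real.exp_pos K).ne' (norm_ne_zero_iff.2 h0), Real.log_exp,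
    intervalIntegral.integral_add intervalIntegrable_const hbi, intervalIntegral.integral_const,
    mul_add, smul_eq_mul, sub_zero, inv_mul_cancel_left₀ (by positivity)] at key
  linarith

end TProd

/-! ### Harmonic measure of the strip, through a conformal map from the disc. -/

namespace TProd

open Filter Topology MeasureTheory Metric

/-- A conformal map of the unit disc onto the right half plane. -/
noncomputable def diskToHalfPlane (θ : ℝ) (w : ℂ) : ℂ :=
  -(Complex.I * (Real.cos (Real.pi * θ) : ℂ)) + (Real.sin (Real.pi * θ) : ℂ) * ((1 + w) / (1 - w))

/-- A conformal map of the unit disc onto the strip `0 < re z < 1`, with `0 ↦ θ`. -/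
noncomputable def diskToStrip (θ : ℝ) (w : ℂ) : ℂ :=
  1 / 2 - Complex.I * (Complex.log (diskToHalfPlane θ w) / Real.pi)

theorem sin_pi_mul_pos {θ : ℝ} (h0 : 0 < θ) (h1 : θ < 1) : 0 < Real.sin (Real.pi * θ) :=
  Real.sin_pos_of_pos_of_lt_pi (mul_pos Real.pi_pos h0) (by nlinarith [Real.pi_pos])

theorem one_sub_ne_zero_of_mem_ball {w : ℂ} (hw : w ∈ ball (0 : ℂ) 1) : 1 - w ≠ 0 := by
  intro h
  rw [mem_ball_zero_iff, ← sub_eq_zero.1 h] at hw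
  simp at hw

/-- The real part of `(1 + w) / (1 - w)` is the Poisson kernel `(1 - |w|²) / |1 - w|²`; the added
constant is purely imaginary. -/
theorem re_diskToHalfPlane_pos {θ : ℝ} (h0 : 0 < θ) (h1 : θ < 1) {w : ℂ}
    (hw : w ∈ ball (0 : ℂ) 1) : 0 < (diskToHalfPlane θ w).re := by
  have hs := sin_pi_mul_pos h0 h1
  have hne := one_sub_ne_zero_of_mem_ball hw
  have hn : 0 < Complex.normSq (1 - w) := Complex.normSq_pos.2 hne
  have hw2 : w.re * w.re + w.im * w.im < 1 := by
    rw [mem_ball_zero_iff] at hw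
    rw [← Complex.normSq_apply, Complex.normSq_eq_norm_sq]
    nlinarith [norm_nonneg w]
  have hre : (diskToHalfPlane θ w).re =
      Real.sin (Real.pi * θ) * ((1 - (w.re * w.re + w.im * w.im)) / Complex.normSq (1 - w)) := by
    simp only [diskToHalfPlane, Complex.add_re, Complex.neg_re, Complex.mul_re, Complex.I_re,
      Complex.I_im, Complex.ofReal_re, Complex.ofReal_im, Complex.div_re, Complex.one_re,
      Complex.sub_re, Complex.add_im, Complex.one_im, Complex.sub_im]
    ring
  rw [hre]
  exact mul_pos hs (div_pos (by linarith) hn)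

theorem differentiableOn_diskToStrip {θ : ℝ} (h0 : 0 < θ) (h1 : θ < 1) :
    DifferentiableOn ℂ (diskToStrip θ) (ball 0 1) := by
  intro w hw
  have hne := one_sub_ne_zero_of_mem_ball hw
  have hk : DifferentiableAt ℂ (diskToHalfPlane θ) w := by
    unfold diskToHalfPlane
    fun_prop (disch := assumption)
  have hsl : diskToHalfPlane θ w ∈ Complex.slitPlane :=
    Or.inl (re_diskToHalfPlane_pos h0 h1 hw)
  exact ((((hk.clog hsl).div_const _).const_mul _).const_sub _).differentiableWithinAt

theorem re_diskToStrip (θ : ℝ) (w : ℂ) :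
    (diskToStrip θ w).re = 1 / 2 + (diskToHalfPlane θ w).arg / Real.pi := by
  simp [diskToStrip, Complex.div_ofReal_im, Complex.log_im]

theorem re_diskToStrip_mem {θ : ℝ} (h0 : 0 < θ) (h1 : θ < 1) {w : ℂ} (hw : w ∈ ball (0 : ℂ) 1) :
    0 ≤ (diskToStrip θ w).re ∧ (diskToStrip θ w).re ≤ 1 := by
  have h := abs_lt.1 (Complex.abs_arg_lt_pi_div_two_iff.2
    (Or.inl (re_diskToHalfPlane_pos h0 h1 hw)))
  have hpi := Real.pi_pos
  rw [re_diskToStrip]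
  have e1 : -(1 / 2) ≤ (diskToHalfPlane θ w).arg / Real.pi := by
    rw [le_div_iff₀ hpi]; linarith
  have e2 : (diskToHalfPlane θ w).arg / Real.pi ≤ 1 / 2 := by
    rw [div_le_iff₀ hpi]; linarith
  constructor <;> linarith

/-- The constants in `diskToHalfPlane` are chosen for this: at the centre its value is `sin πθ - i
cos πθ`, of modulus one and argument `πθ - π/2`. -/
theorem diskToStrip_zero {θ : ℝ} (h0 : 0 < θ) (h1 : θ < 1) : diskToStrip θ 0 = θ := by
  have hpi := Real.pi_pos
  have hpi' : (Real.pi : ℂ) ≠ 0 := by exact_mod_cast hpi.ne'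
  have e : diskToHalfPlane θ 0 =
      Complex.exp (((Real.pi * θ - Real.pi / 2 : ℝ) : ℂ) * Complex.I) := by
    rw [Complex.exp_mul_I, ← Complex.ofReal_cos, ← Complex.ofReal_sin, Real.cos_sub_pi_div_two,
      Real.sin_sub_pi_div_two]
    simp [diskToHalfPlane]
    ring
  have e2 : Complex.log (diskToHalfPlane θ 0) =
      ((Real.pi * θ - Real.pi / 2 : ℝ) : ℂ) * Complex.I := by
    rw [e, Complex.log_exp]
    · simp; nlinarith
    · simp; nlinarith
  rw [diskToStrip, e2]
  push_cast
  field_simp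
  ring_nf
  simp only [Complex.I_sq]
  ring

theorem circleMap_one_sub_ne {s : ℝ} (hs : Real.sin (s / 2) ≠ 0) : 1 - circleMap 0 1 s ≠ 0 := by
  intro h
  have h2 : circleMap 0 1 s = 1 := (sub_eq_zero.1 h).symm
  have h3 := congrArg Complex.re h2
  rw [circleMap_zero, Complex.ofReal_one, one_mul, Complex.exp_ofReal_mul_I_re, Complex.one_re]
    at h3
  have h4 := Real.cos_two_mul (s / 2)
  rw [mul_div_cancel₀ s two_ne_zero, h3] at h4
  have h5 := Real.sin_sq_add_cos_sq (s / 2)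
  exact hs (pow_eq_zero_iff two_ne_zero |>.1 (by nlinarith))

/-- On the circle `(1 + w) / (1 - w) = i cot (s / 2)`, and the subtraction formula for the sine
collects the terms. The sign of the quotient then decides which edge of the strip is reached:
positive for `re z = 1`, negative for `re z = 0`. -/
theorem diskToHalfPlane_circleMap (θ : ℝ) {s : ℝ} (hs : Real.sin (s / 2) ≠ 0) :
    diskToHalfPlane θ (circleMap 0 1 s) =
      Complex.I * ((Real.sin (Real.pi * θ - s / 2) / Real.sin (s / 2) : ℝ) : ℂ) := by
  have hne := circleMap_one_sub_ne hs
  have hs' : (Real.sin (s / 2) : ℂ) ≠ 0 := by exact_mod_cast hs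
  have hc : circleMap 0 1 s =
      ((Real.cos (s / 2) : ℂ) + Real.sin (s / 2) * Complex.I) ^ 2 := by
    rw [circleMap_zero, Complex.ofReal_one, one_mul, Complex.ofReal_cos, Complex.ofReal_sin,
      ← Complex.exp_mul_I, ← Complex.exp_nat_mul]
    congr 1
    push_cast
    ring
  have hcs : (Real.cos (s / 2) : ℂ) ^ 2 = 1 - (Real.sin (s / 2) : ℂ) ^ 2 := by
    have := Real.sin_sq_add_cos_sq (s / 2)
    rw [eq_sub_iff_add_eq', ← Complex.ofReal_pow, ← Complex.ofReal_pow, ← Complex.ofReal_add, this,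
      Complex.ofReal_one]
  have hq : (1 + circleMap 0 1 s) / (1 - circleMap 0 1 s) =
      Complex.I * Real.cos (s / 2) / Real.sin (s / 2) := by
    rw [div_eq_div_iff hne hs', hc]
    linear_combination (Complex.I * Real.cos (s / 2) - Real.sin (s / 2) : ℂ) * hcs +
      (Real.sin (s / 2) ^ 3 + 2 * Real.cos (s / 2) ^ 2 * Real.sin (s / 2) +
        Complex.I * Real.cos (s / 2) * Real.sin (s / 2) ^ 2 : ℂ) * Complex.I_sq
  rw [diskToHalfPlane, hq, Real.sin_sub]
  simp only [Complex.ofReal_div, Complex.ofReal_sub, Complex.ofReal_mul]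
  field_simp
  ring

theorem diskToStrip_circleMap_of_pos (θ : ℝ) {s : ℝ} (hs : Real.sin (s / 2) ≠ 0)
    (hρ : 0 < Real.sin (Real.pi * θ - s / 2) / Real.sin (s / 2)) :
    diskToStrip θ (circleMap 0 1 s) = 1 + Complex.I * ((-(Real.log
      (Real.sin (Real.pi * θ - s / 2) / Real.sin (s / 2))) / Real.pi : ℝ) : ℂ) := by
  have hpi : (Real.pi : ℂ) ≠ 0 := by exact_mod_cast Real.pi_ne_zero
  rw [diskToStrip, diskToHalfPlane_circleMap θ hs]
  set ρ := Real.sin (Real.pi * θ - s / 2) / Real.sin (s / 2)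
  rw [mul_comm Complex.I (ρ : ℂ), Complex.log_ofReal_mul hρ Complex.I_ne_zero, Complex.log_I]
  push_cast
  field_simp
  linear_combination (-Real.pi : ℂ) * Complex.I_sq

theorem diskToStrip_circleMap_of_neg (θ : ℝ) {s : ℝ} (hs : Real.sin (s / 2) ≠ 0)
    (hρ : Real.sin (Real.pi * θ - s / 2) / Real.sin (s / 2) < 0) :
    ∃ t : ℝ, diskToStrip θ (circleMap 0 1 s) = Complex.I * t := by
  have hpi : (Real.pi : ℂ) ≠ 0 := by exact_mod_cast Real.pi_ne_zero
  rw [diskToStrip, diskToHalfPlane_circleMap θ hs]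
  set ρ := Real.sin (Real.pi * θ - s / 2) / Real.sin (s / 2)
  refine ⟨-(Real.log (-ρ)) / Real.pi, ?_⟩
  have e : Complex.I * (ρ : ℂ) = ((-ρ : ℝ) : ℂ) * -Complex.I := by push_cast; ring
  rw [e, Complex.log_ofReal_mul (neg_pos.2 hρ) (neg_ne_zero.2 Complex.I_ne_zero), Complex.log_neg_I]
  push_cast
  field_simp
  linear_combination (Real.pi : ℂ) * Complex.I_sq

theorem tendsto_diskToStrip_circleMap (θ : ℝ) {s : ℝ} (hs : Real.sin (s / 2) ≠ 0)
    (hρ : Real.sin (Real.pi * θ - s / 2) / Real.sin (s / 2) ≠ 0) :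
    Tendsto (fun r : ℝ => diskToStrip θ (circleMap 0 r s)) (𝓝[<] 1)
      (𝓝 (diskToStrip θ (circleMap 0 1 s))) := by
  have hne := circleMap_one_sub_ne hs
  have hsl : diskToHalfPlane θ (circleMap 0 1 s) ∈ Complex.slitPlane := by
    rw [diskToHalfPlane_circleMap θ hs]
    refine Or.inr ?_
    rwa [Complex.I_mul_im, Complex.ofReal_re]
  have hk : ContinuousAt (diskToHalfPlane θ) (circleMap 0 1 s) := by
    unfold diskToHalfPlane
    fun_prop (disch := assumption)
  have hk2 : ContinuousAt (diskToStrip θ) (circleMap 0 1 s) :=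
    continuousAt_const.sub (continuousAt_const.mul ((hk.clog hsl).div_const _))
  have hc : Continuous fun r : ℝ => circleMap 0 r s := by
    unfold circleMap
    fun_prop
  exact (hk2.tendsto.comp hc.continuousAt.tendsto).mono_left nhdsWithin_le_nhds

/-- The harmonic majorant on the strip `0 ≤ re z ≤ 1`, at a point of the real axis. -/
theorem log_norm_le_integral_strip {h : ℂ → ℂ} {B : ℝ → ℝ} {M K θ : ℝ} (hd : Differentiable ℂ h)
    (hM : ∀ z : ℂ, 0 ≤ z.re → z.re ≤ 1 → ‖h z‖ ≤ M) (h0 : ∀ t : ℝ, ‖h (Complex.I * t)‖ ≤ 1)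
    (h1 : ∀ t : ℝ, ‖h (1 + Complex.I * t)‖ ≤ Real.exp (B t)) (hB : Continuous B)
    (hK : ∀ t, |B t| ≤ K) (hθ0 : 0 < θ) (hθ1 : θ < 1) (hθ : h θ ≠ 0) :
    Real.log ‖h θ‖ ≤ (2 * Real.pi)⁻¹ * ∫ s in (0 : ℝ)..2 * Real.pi * θ,
      B (-(Real.log (Real.sin (Real.pi * θ - s / 2) / Real.sin (s / 2))) / Real.pi) := by
  have hpi := Real.pi_pos
  have hK0 : 0 ≤ K := (abs_nonneg _).trans (hK 0)
  set u : ℝ → ℝ := fun s =>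
    B (-(Real.log (Real.sin (Real.pi * θ - s / 2) / Real.sin (s / 2))) / Real.pi) with hu
  have hum : Measurable u := by
    refine hB.measurable.comp ?_
    fun_prop
  -- The arc `s < 2πθ` goes to the edge `re z = 1`, where the bound is `B`; the remaining arc goes
  -- to `re z = 0`, where the bound on `log ‖h‖` is `0`.
  set b : ℝ → ℝ := (Set.Iic (2 * Real.pi * θ)).indicator u with hb
  have hbm : Measurable b := hum.indicator measurableSet_Iic
  have hbK : ∀ s, |b s| ≤ K := by
    intro s
    by_cases hs : s ∈ Set.Iic (2 * Real.pi * θ)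
    · rw [hb, Set.indicator_of_mem hs]; exact hK _
    · rw [hb, Set.indicator_of_notMem hs, abs_zero]; exact hK0
  have key := log_norm_le_integral_of_radial_limit (g := fun w => h (diskToStrip θ w)) (b := b)
    (M := M) (K := K)
    (hd.comp_differentiableOn (differentiableOn_diskToStrip hθ0 hθ1))
    (fun w hw => hM _ (re_diskToStrip_mem hθ0 hθ1 hw).1 (re_diskToStrip_mem hθ0 hθ1 hw).2)
    (by rwa [diskToStrip_zero hθ0 hθ1]) hbm hbK ?_
  · rw [diskToStrip_zero hθ0 hθ1] at key
    refine key.trans_eq ?_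
    congr 1
    rw [intervalIntegral.integral_of_le (by positivity), intervalIntegral.integral_of_le
      (by positivity), hb, setIntegral_indicator measurableSet_Iic]
    congr 2
    ext s
    simp only [Set.mem_inter_iff, Set.mem_Ioc, Set.mem_Iic]
    constructor
    · rintro ⟨⟨a, _⟩, c⟩; exact ⟨a, c⟩
    · rintro ⟨a, c⟩; exact ⟨⟨a, c.trans (by nlinarith)⟩, c⟩
  -- The two excluded parameters correspond to the ends of the strip: at `2π` the map to the half
  -- plane has its pole, at `2πθ` it has its zero.
  · have hne : ∀ a : ℝ, ∀ᵐ s : ℝ, s ≠ a := fun a => by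
      simp [ae_iff, measure_singleton]
    rw [ae_restrict_iff' measurableSet_uIoc]
    filter_upwards [hne (2 * Real.pi), hne (2 * Real.pi * θ)] with s hs1 hs2 hs
    rw [Set.uIoc_of_le (by positivity)] at hs
    have hs3 : s < 2 * Real.pi := lt_of_le_of_ne hs.2 hs1
    have hsin : 0 < Real.sin (s / 2) :=
      Real.sin_pos_of_pos_of_lt_pi (by linarith [hs.1]) (by linarith)
    refine ⟨h (diskToStrip θ (circleMap 0 1 s)), ?_, ?_⟩
    · refine (hd.continuous.tendsto _).comp (tendsto_diskToStrip_circleMap θ hsin.ne' ?_)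
      refine div_ne_zero ?_ hsin.ne'
      intro h0
      have := (Real.sin_eq_zero_iff_of_lt_of_lt (by nlinarith [hs.1]) (by nlinarith [hs.1])).1 h0
      exact hs2 (by linarith)
    · rcases lt_or_gt_of_ne hs2 with hlt | hgt
      · rw [diskToStrip_circleMap_of_pos θ hsin.ne' (div_pos
          (Real.sin_pos_of_pos_of_lt_pi (by linarith) (by nlinarith [hs.1])) hsin), hb,
          Set.indicator_of_mem (show s ∈ Set.Iic (2 * Real.pi * θ) from hlt.le)]
        exact h1 _
      · obtain ⟨t, ht⟩ := diskToStrip_circleMap_of_neg θ hsin.ne' (div_neg_of_neg_of_pos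
          (Real.sin_neg_of_neg_of_neg_pi_lt (by linarith) (by nlinarith [hs.1])) hsin)
        rw [ht, hb, Set.indicator_of_notMem (by simpa using hgt), Real.exp_zero]
        exact h0 t

end TProd

/-! ### The density `β₀` and the limit at the boundary of the strip. -/

namespace TProd

open Filter Topology MeasureTheory Metric

theorem beta0_pos (t : ℝ) : 0 < beta0 t :=
  div_pos Real.pi_pos (by linarith [Real.one_le_cosh (Real.pi * t)])

theorem continuous_beta0 : Continuous beta0 := by
  unfold beta0
  refine Continuous.div (by fun_prop) (by fun_prop) fun t => ?_
  linarith [Real.one_le_cosh (Real.pi * t)]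

/-- The distribution function of `beta0`. -/
noncomputable def beta0Cdf (t : ℝ) : ℝ := (1 + Real.exp (-(Real.pi * t)))⁻¹

theorem hasDerivAt_beta0Cdf (t : ℝ) : HasDerivAt beta0Cdf (beta0 t) t := by
  have h1 : HasDerivAt (fun t : ℝ => 1 + Real.exp (-(Real.pi * t)))
      (Real.exp (-(Real.pi * t)) * -(Real.pi * 1)) t :=
    (((hasDerivAt_id t).const_mul Real.pi).neg.exp).const_add 1
  have hpos : 0 < 1 + Real.exp (-(Real.pi * t)) := by positivity
  refine (h1.inv hpos.ne').congr_deriv ?_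
  rw [beta0, Real.cosh_eq]
  have e : Real.exp (Real.pi * t) = (Real.exp (-(Real.pi * t)))⁻¹ := by
    rw [Real.exp_neg, inv_inv]
  rw [e]
  have hp : 0 < Real.exp (-(Real.pi * t)) := Real.exp_pos _
  field_simp
  ring

theorem one_sub_div_beta0Cdf (t : ℝ) :
    (1 - beta0Cdf t) / beta0Cdf t = Real.exp (-(Real.pi * t)) := by
  have hp : 0 < Real.exp (-(Real.pi * t)) := Real.exp_pos _
  rw [beta0Cdf]
  field_simp
  ring

theorem neg_log_beta0Cdf (t : ℝ) :
    -(Real.log ((1 - beta0Cdf t) / beta0Cdf t)) / Real.pi = t := by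
  rw [one_sub_div_beta0Cdf, Real.log_exp, neg_neg, mul_div_cancel_left₀ _ Real.pi_ne_zero]

theorem injective_beta0Cdf : Function.Injective beta0Cdf := fun x y h => by
  rw [← neg_log_beta0Cdf x, h, neg_log_beta0Cdf y]

theorem range_beta0Cdf : beta0Cdf '' Set.univ = Set.Ioo 0 1 := by
  ext v
  constructor
  · rintro ⟨t, -, rfl⟩
    have hp : 0 < Real.exp (-(Real.pi * t)) := Real.exp_pos _
    exact ⟨inv_pos.2 (by positivity), inv_lt_one_of_one_lt₀ (by linarith)⟩
  · rintro ⟨h0, h1⟩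
    refine ⟨-(Real.log ((1 - v) / v)) / Real.pi, trivial, ?_⟩
    have hq : 0 < (1 - v) / v := div_pos (by linarith) h0
    have hpi := Real.pi_ne_zero
    rw [beta0Cdf, mul_div_cancel₀ _ hpi, neg_neg, Real.exp_log hq]
    field_simp
    ring

/-- The substitution `v = beta0Cdf t`; its inverse is the function of `v` to which `B` is applied.
In this form the integral is visibly the limit of the strip integrals as `θ → 0`. -/
theorem integral_mul_beta0 (B : ℝ → ℝ) :
    ∫ t, B t * beta0 t = ∫ v in (0 : ℝ)..1, B (-(Real.log ((1 - v) / v)) / Real.pi) := by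
  have h := integral_image_eq_integral_abs_deriv_smul MeasurableSet.univ
    (fun x _ => (hasDerivAt_beta0Cdf x).hasDerivWithinAt) injective_beta0Cdf.injOn
    (fun v => B (-(Real.log ((1 - v) / v)) / Real.pi))
  rw [intervalIntegral.integral_of_le zero_le_one, integral_Ioc_eq_integral_Ioo, ← range_beta0Cdf,
    h, Measure.restrict_univ]
  refine integral_congr_ae (ae_of_all _ fun t => ?_)
  simp only [neg_log_beta0Cdf, abs_of_pos (beta0_pos t), smul_eq_mul, mul_comm]

theorem integral_beta0 : ∫ t, beta0 t = 1 := by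
  have := integral_mul_beta0 (fun _ => 1)
  simpa using this

/-- The integral of a non-integrable function is `0` by convention, whereas here it is `1`. -/
theorem integrable_beta0 : Integrable beta0 := by
  by_contra h
  have := integral_undef h
  rw [integral_beta0] at this
  exact one_ne_zero this

theorem tendsto_sin_div_sin (a : ℝ) {b : ℝ} (hb : b ≠ 0) :
    Tendsto (fun x : ℝ => Real.sin (x * a) / Real.sin (x * b)) (𝓝[>] 0) (𝓝 (a / b)) := by
  have key : ∀ c : ℝ, Tendsto (fun x : ℝ => Real.sin (x * c) / x) (𝓝[>] 0) (𝓝 c) := by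
    intro c
    have h : HasDerivAt (fun x : ℝ => Real.sin (x * c)) c 0 := by
      simpa using ((hasDerivAt_id (0 : ℝ)).mul_const c).sin
    have h2 := h.tendsto_slope_zero_right
    simpa [div_eq_inv_mul] using h2
  refine ((key a).div (key b) hb).congr' ?_
  filter_upwards [self_mem_nhdsWithin] with x hx
  have hx' : x ≠ 0 := ne_of_gt hx
  change _ / x / (_ / x) = _
  rw [div_div_div_cancel_right₀ hx']

/-- Near `0` one has `log ‖h‖ = re (log h)`, and the derivative of `log h` at `0` is `h'` because `h
0 = 1`. -/
theorem tendsto_log_norm_div {h : ℂ → ℂ} {h' : ℂ} (hd : HasDerivAt h h' 0) (h0 : h 0 = 1) :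
    Tendsto (fun θ : ℝ => θ⁻¹ * Real.log ‖h θ‖) (𝓝[>] 0) (𝓝 h'.re) := by
  have h1 : HasDerivAt (fun z => Complex.log (h z)) h' 0 := by
    simpa [h0] using hd.clog (by rw [h0]; exact Complex.one_mem_slitPlane)
  have h2 := (HasDerivAt.real_of_complex (z := 0) (by exact_mod_cast h1)).tendsto_slope_zero_right
  simpa [h0, Complex.log_re] using h2

/-- An infinitesimal form of Hirschman's strengthening of the three lines theorem, at the boundary
of the strip. -/
theorem re_deriv_le_integral_mul_beta0 {h : ℂ → ℂ} {h' : ℂ} {B : ℝ → ℝ} {M K : ℝ}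
    (hd : Differentiable ℂ h) (hM : ∀ z : ℂ, 0 ≤ z.re → z.re ≤ 1 → ‖h z‖ ≤ M)
    (h0 : ∀ t : ℝ, ‖h (Complex.I * t)‖ ≤ 1)
    (h1 : ∀ t : ℝ, ‖h (1 + Complex.I * t)‖ ≤ Real.exp (B t)) (hB : Continuous B)
    (hK : ∀ t, |B t| ≤ K) (hh0 : h 0 = 1) (hh' : HasDerivAt h h' 0) :
    h'.re ≤ ∫ t, B t * beta0 t := by
  have hpi := Real.pi_pos
  rw [integral_mul_beta0]
  have hne : ∀ᶠ θ : ℝ in 𝓝[>] 0, h θ ≠ 0 := by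
    have hc : ContinuousAt (fun θ : ℝ => h θ) 0 := by
      have := hd.continuous
      fun_prop
    exact (hc.eventually_ne (by simp [hh0])).filter_mono nhdsWithin_le_nhds
  have hle : ∀ᶠ θ : ℝ in 𝓝[>] 0, θ⁻¹ * Real.log ‖h θ‖ ≤ ∫ v in (0 : ℝ)..1,
      B (-(Real.log (Real.sin (θ * (Real.pi * (1 - v))) / Real.sin (θ * (Real.pi * v))))
        / Real.pi) := by
    filter_upwards [hne, Ioo_mem_nhdsGT (zero_lt_one : (0 : ℝ) < 1)] with θ hθ hθ01
    have hθ0 := hθ01.1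
    have key := log_norm_le_integral_strip hd hM h0 h1 hB hK hθ01.1 hθ01.2 hθ
    -- Rescaling by `s = 2πθv` fixes the interval of integration and extracts the factor `θ`. As `θ
    -- → 0` the quotient of sines tends to `(1 - v) / v`.
    have hsub := intervalIntegral.integral_comp_mul_left (a := 0) (b := 1) (fun s =>
      B (-(Real.log (Real.sin (Real.pi * θ - s / 2) / Real.sin (s / 2))) / Real.pi))
      (c := 2 * Real.pi * θ) (by positivity)
    rw [mul_zero, mul_one, smul_eq_mul] at hsub
    have hsub2 : ∫ v in (0 : ℝ)..1,
      B (-(Real.log (Real.sin (θ * (Real.pi * (1 - v))) / Real.sin (θ * (Real.pi * v))))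
        / Real.pi) = (2 * Real.pi * θ)⁻¹ * ∫ s in (0 : ℝ)..2 * Real.pi * θ,
      B (-(Real.log (Real.sin (Real.pi * θ - s / 2) / Real.sin (s / 2))) / Real.pi) := by
      rw [← hsub]
      congr 1
      ext v
      rw [show Real.pi * θ - 2 * Real.pi * θ * v / 2 = θ * (Real.pi * (1 - v)) by ring,
        show 2 * Real.pi * θ * v / 2 = θ * (Real.pi * v) by ring]
    rw [hsub2, mul_inv, mul_comm _ θ⁻¹, mul_assoc]
    exact mul_le_mul_of_nonneg_left key (inv_nonneg.2 hθ0.le)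
  refine le_of_tendsto_of_tendsto (tendsto_log_norm_div hh' hh0) ?_ hle
  refine intervalIntegral.tendsto_integral_filter_of_dominated_convergence (fun _ => K) ?_ ?_ ?_ ?_
  · refine Eventually.of_forall fun θ => (hB.measurable.comp ?_).aestronglyMeasurable
    fun_prop
  · exact Eventually.of_forall fun θ => ae_of_all _ fun v _ => hK _
  · exact intervalIntegrable_const
  · have hne1 : ∀ᵐ v : ℝ, v ≠ 1 := by simp [ae_iff, measure_singleton]
    filter_upwards [hne1] with v hv1 hv
    rw [Set.uIoc_of_le zero_le_one] at hv
    have hv0 := hv.1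
    have hv2 : 0 < 1 - v := sub_pos.2 (lt_of_le_of_ne hv.2 hv1)
    have ht := tendsto_sin_div_sin (Real.pi * (1 - v)) (b := Real.pi * v) (by positivity)
    rw [mul_div_mul_left _ _ hpi.ne'] at ht
    exact (hB.tendsto _).comp (((ht.log (by positivity)).neg).div_const _)

end TProd

/-! ### Majorization and convex symmetric functions. -/

namespace TProd

open Filter Topology MeasureTheory Metric

/-- Summation by parts against an antitone weight. -/
theorem mul_sum_le_sum_mul_of_partial_sums_nonneg : ∀ {m : ℕ} {c u : Fin m → ℝ} {e : ℝ},
    Antitone c → (∀ i, e ≤ c i) →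
    (∀ (j : ℕ) (hj : j ≤ m), 0 ≤ ∑ i : Fin j, u (Fin.castLE hj i)) →
    e * ∑ i, u i ≤ ∑ i, c i * u i
  | 0, c, u, e, _, _, _ => by simp
  | m + 1, c, u, e, hc, he, hu => by
    have ih := mul_sum_le_sum_mul_of_partial_sums_nonneg (c := fun i : Fin m => c i.castSucc)
      (u := fun i : Fin m => u i.castSucc) (e := c (Fin.last m))
      (fun i j hij => hc (by simpa using hij)) (fun i => hc (Fin.le_last _))
      (fun j hj => hu j (hj.trans m.le_succ))
    have hS : 0 ≤ ∑ i, u i := hu (m + 1) le_rfl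
    rw [Fin.sum_univ_castSucc] at hS
    rw [Fin.sum_univ_castSucc, Fin.sum_univ_castSucc]
    nlinarith [he (Fin.last m)]

/-- If `x` is majorized by `d`, then a linear functional at `x` is at most its value at some
rearrangement of `d`. -/
theorem exists_perm_sum_mul_le {m : ℕ} {x d : Fin m → ℝ} (hx : Antitone x)
    (hle : ∀ (j : ℕ) (hj : j ≤ m),
      ∑ i : Fin j, x (Fin.castLE hj i) ≤ ∑ i : Fin j, d (Fin.castLE hj i))
    (heq : ∑ i, x i = ∑ i, d i) (c : Fin m → ℝ) :
    ∃ σ : Equiv.Perm (Fin m), ∑ i, c i * x i ≤ ∑ i, c i * d (σ i) := by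
  set τ : Equiv.Perm (Fin m) := Tuple.sort fun i => -c i with hτ
  have hanti : Antitone fun i => c (τ i) := by
    intro i j hij
    have := Tuple.monotone_sort (fun i => -c i) hij
    simp only [Function.comp_apply, neg_le_neg_iff] at this
    exact this
  have hmono : Monovary (fun i => c (τ i)) x := hanti.monovary hx
  refine ⟨τ⁻¹, ?_⟩
  have h1 : ∑ i, c i * x i ≤ ∑ i, c (τ i) * x i := by
    rw [← Equiv.sum_comp τ]
    exact hmono.sum_mul_comp_perm_le_sum_mul
  have h3 : ∑ i, c i * d (τ⁻¹ i) = ∑ i, c (τ i) * d i := by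
    rw [← Equiv.sum_comp τ]
    simp
  rw [h3]
  refine h1.trans ?_
  -- The smallest sorted weight serves as the lower bound `e`, which requires an index. It drops out
  -- because it multiplies `∑ (d i - x i) = 0`.
  rcases m with _ | m
  · simp
  have h2 := mul_sum_le_sum_mul_of_partial_sums_nonneg (u := fun i => d i - x i) hanti
    (fun i => hanti (Fin.le_last i)) fun j hj => by
      rw [Finset.sum_sub_distrib, sub_nonneg]
      exact hle j hj
  simp only [mul_sub, Finset.sum_sub_distrib, heq, sub_self] at h2
  linarith

/-- The Hardy–Littlewood–Pólya theorem, for families of vectors. -/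
theorem mem_convexHull_of_majorized {p m : ℕ} {x d : Fin p → Fin m → ℝ} (hx : ∀ k, Antitone (x k))
    (hle : ∀ k (j : ℕ) (hj : j ≤ m),
      ∑ i : Fin j, x k (Fin.castLE hj i) ≤ ∑ i : Fin j, d k (Fin.castLE hj i))
    (heq : ∀ k, ∑ i, x k i = ∑ i, d k i) :
    x ∈ convexHull ℝ (Set.range fun (σ : Fin p → Equiv.Perm (Fin m)) k i => d k (σ k i)) := by
  by_contra hmem
  -- A functional separating `x` from the hull is a sum over the blocks, so a best rearrangement can
  -- be chosen in each block independently. The resulting vertex contradicts the separation.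
  obtain ⟨f, u, hf, hu⟩ := geometric_hahn_banach_closed_point (convex_convexHull ℝ _)
    ((Set.finite_range fun (σ : Fin p → Equiv.Perm (Fin m)) k i =>
      d k (σ k i)).isClosed_convexHull ℝ) hmem
  have hrep : ∀ v, f v = ∑ k, ∑ i, f (Pi.single k (Pi.single i 1)) * v k i := by
    intro v
    have hv : v = ∑ k, ∑ i, v k i • (Pi.single k (Pi.single i (1 : ℝ)) : Fin p → Fin m → ℝ) := by
      ext k i
      simp [Finset.sum_apply, Pi.single_apply, apply_ite, ite_apply]
    conv_lhs => rw [hv]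
    simp [map_sum, mul_comm]
  choose σ hσ using fun k => exists_perm_sum_mul_le (hx k) (hle k) (heq k)
    fun i => f (Pi.single k (Pi.single i 1))
  have h1 := hf _ (subset_convexHull ℝ _ ⟨σ, rfl⟩)
  rw [hrep] at h1 hu
  have h2 := Finset.sum_le_sum fun k (_ : k ∈ Finset.univ) => hσ k
  linarith

/-- The probability measure with density `beta0`. -/
noncomputable def beta0Measure : Measure ℝ :=
  volume.withDensity fun t => ENNReal.ofReal (beta0 t)

theorem integral_beta0Measure (u : ℝ → ℝ) : ∫ t, u t ∂beta0Measure = ∫ t, u t * beta0 t := by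
  rw [beta0Measure, integral_withDensity_eq_integral_toReal_smul
    continuous_beta0.measurable.ennreal_ofReal (by simp)]
  simp [ENNReal.toReal_ofReal (beta0_pos _).le, mul_comm]

theorem integrable_beta0Measure_iff (u : ℝ → ℝ) :
    Integrable u beta0Measure ↔ Integrable fun t => u t * beta0 t := by
  rw [beta0Measure, integrable_withDensity_iff continuous_beta0.measurable.ennreal_ofReal (by simp)]
  simp [ENNReal.toReal_ofReal (beta0_pos _).le]

instance isProbabilityMeasure_beta0Measure : IsProbabilityMeasure beta0Measure := by
  constructor
  rw [beta0Measure, withDensity_apply _ MeasurableSet.univ, Measure.restrict_univ,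
    ← ofReal_integral_eq_lintegral_ofReal integrable_beta0 (ae_of_all _ fun t => (beta0_pos t).le),
    integral_beta0, ENNReal.ofReal_one]

theorem integrable_beta0Measure_of_bounded {E : Type*} [NormedAddCommGroup E]
    [SecondCountableTopologyEither ℝ E] {u : ℝ → E}
    (hu : Continuous u) {K : ℝ} (hK : ∀ t, ‖u t‖ ≤ K) : Integrable u beta0Measure :=
  Integrable.of_bound hu.aestronglyMeasurable K (ae_of_all _ hK)

/-- Convex symmetric functions increase along an averaged majorization. -/
theorem convexOn_le_integral_of_majorized {p m : ℕ} {Θ : (Fin p → Fin m → ℝ) → ℝ}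
    (hΘ : ConvexOn ℝ Set.univ Θ) (hΘc : Continuous Θ)
    (hΘs : ∀ (σ : Fin p → Equiv.Perm (Fin m)) v, Θ (fun k i => v k (σ k i)) = Θ v)
    {x : Fin p → Fin m → ℝ} {y : ℝ → Fin p → Fin m → ℝ} (hx : ∀ k, Antitone (x k))
    (hy : Continuous y) {K : ℝ} (hK : ∀ t, ‖y t‖ ≤ K)
    (hle : ∀ k (j : ℕ) (hj : j ≤ m), ∑ i : Fin j, x k (Fin.castLE hj i) ≤
      ∫ t, (∑ i : Fin j, y t k (Fin.castLE hj i)) * beta0 t)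
    (heq : ∀ k t, ∑ i, y t k i = ∑ i, x k i) :
    Integrable (fun t => Θ (y t) * beta0 t) ∧ Θ x ≤ ∫ t, Θ (y t) * beta0 t := by
  have hyi : Integrable y beta0Measure := integrable_beta0Measure_of_bounded hy hK
  have hyki : ∀ k i, Integrable (fun t => y t k i) beta0Measure := fun k i =>
    (hyi.eval k).eval i
  have hΘi : Integrable (fun t => Θ (y t)) beta0Measure := by
    obtain ⟨C, hC⟩ := (isCompact_closedBall (0 : Fin p → Fin m → ℝ) K).exists_bound_of_continuousOn
      hΘc.continuousOn
    exact integrable_beta0Measure_of_bounded (hΘc.comp hy)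
      fun t => hC _ (mem_closedBall_zero_iff.2 (hK t))
  refine ⟨(integrable_beta0Measure_iff _).1 hΘi, ?_⟩
  rw [← integral_beta0Measure]
  set d := ∫ t, y t ∂beta0Measure with hd
  have hdki : ∀ k i, d k i = ∫ t, y t k i ∂beta0Measure := by
    intro k i
    rw [hd, eval_integral fun k => hyi.eval k, eval_integral fun i => (hyi.eval k).eval i]
  have hmem := mem_convexHull_of_majorized (d := d) hx
    (fun k j hj => by
      refine (hle k j hj).trans_eq ?_
      rw [← integral_beta0Measure, integral_finsetSum _ fun i _ => hyki k _]
      simp only [hdki])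
    (fun k => by
      simp only [hdki]
      rw [← integral_finsetSum _ fun i _ => hyki k _]
      simp [heq])
  -- On a convex hull a convex function is dominated by its value at some vertex, and by symmetry
  -- its value at every vertex is `Θ d`. Jensen's inequality for the average `d` concludes.
  obtain ⟨v, ⟨σ, rfl⟩, hv⟩ := (hΘ.subset (Set.subset_univ _) (convex_convexHull ℝ _)
    ).exists_ge_of_mem_convexHull (subset_convexHull ℝ _) hmem
  rw [hΘs] at hv
  exact hv.trans (hΘ.map_integral_le hΘc.continuousOn isClosed_univ (by simp) hyi hΘi)

end TProd

/-! ### Ordered eigenvalues, min-max and compressions. -/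

namespace TProd

open Filter Topology MeasureTheory Metric
open scoped Matrix

/-- The squared Euclidean norm. -/
noncomputable def sqNorm {ι : Type*} [Fintype ι] (x : ι → ℂ) : ℝ := ∑ i, Complex.normSq (x i)

section SqNorm

variable {ι κ : Type*} [Fintype ι] [Fintype κ]

theorem sqNorm_nonneg (x : ι → ℂ) : 0 ≤ sqNorm x :=
  Finset.sum_nonneg fun _ _ => Complex.normSq_nonneg _

theorem ofReal_sqNorm (x : ι → ℂ) : (sqNorm x : ℂ) = star x ⬝ᵥ x := by
  simp only [sqNorm, dotProduct, Complex.ofReal_sum, Pi.star_apply]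
  exact Finset.sum_congr rfl fun i _ => Complex.normSq_eq_conj_mul_self

theorem sqNorm_pos {x : ι → ℂ} (hx : x ≠ 0) : 0 < sqNorm x := by
  obtain ⟨i, hi⟩ := Function.ne_iff.1 hx
  exact Finset.sum_pos' (fun _ _ => Complex.normSq_nonneg _)
    ⟨i, Finset.mem_univ i, Complex.normSq_pos.2 hi⟩

theorem dotProduct_conjTranspose_mul_mulVec (F : Matrix κ ι ℂ) (x : ι → ℂ) :
    star x ⬝ᵥ (Fᴴ * F) *ᵥ x = sqNorm (F *ᵥ x) := by
  rw [ofReal_sqNorm, Matrix.star_mulVec, ← Matrix.dotProduct_mulVec, Matrix.mulVec_mulVec]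

theorem sqNorm_mulVec_of_isometry [DecidableEq ι] {V : Matrix κ ι ℂ} (hV : Vᴴ * V = 1)
    (x : ι → ℂ) : sqNorm (V *ᵥ x) = sqNorm x := by
  have h := dotProduct_conjTranspose_mul_mulVec V x
  rw [hV, Matrix.one_mulVec, ← ofReal_sqNorm] at h
  exact_mod_cast h.symm

/-- Pythagoras for the orthogonal projection `V Vᴴ`: the difference of the two sides is the squared
norm of `x - V Vᴴ x`. -/
theorem sqNorm_conjTranspose_mulVec_le [DecidableEq ι] {V : Matrix κ ι ℂ} (hV : Vᴴ * V = 1)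
    (x : κ → ℂ) : sqNorm (Vᴴ *ᵥ x) ≤ sqNorm x := by
  have h : sqNorm (x - V *ᵥ (Vᴴ *ᵥ x)) = sqNorm x - sqNorm (Vᴴ *ᵥ x) := by
    have e1 : star x ⬝ᵥ V *ᵥ (Vᴴ *ᵥ x) = (sqNorm (Vᴴ *ᵥ x) : ℂ) := by
      rw [← dotProduct_conjTranspose_mul_mulVec, Matrix.conjTranspose_conjTranspose,
        Matrix.mulVec_mulVec]
    have e2 : star (V *ᵥ (Vᴴ *ᵥ x)) ⬝ᵥ x = (sqNorm (Vᴴ *ᵥ x) : ℂ) := by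
      rw [Matrix.star_mulVec, ← Matrix.dotProduct_mulVec, ofReal_sqNorm]
    have e3 := ofReal_sqNorm (V *ᵥ (Vᴴ *ᵥ x))
    rw [sqNorm_mulVec_of_isometry hV] at e3
    have := ofReal_sqNorm (x - V *ᵥ (Vᴴ *ᵥ x))
    rw [star_sub, sub_dotProduct, dotProduct_sub, dotProduct_sub, e1, e2, ← e3, ← ofReal_sqNorm]
      at this
    have h2 : ((sqNorm (x - V *ᵥ (Vᴴ *ᵥ x)) : ℝ) : ℂ) =
        ((sqNorm x - sqNorm (Vᴴ *ᵥ x) : ℝ) : ℂ) := by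
      rw [this]; push_cast; ring
    exact_mod_cast h2
  linarith [sqNorm_nonneg (x - V *ᵥ (Vᴴ *ᵥ x))]

theorem dotProduct_diagonal_mulVec [DecidableEq ι] (a : ι → ℝ) (x : ι → ℂ) :
    (star x ⬝ᵥ (Matrix.diagonal fun i => (a i : ℂ)) *ᵥ x).re =
      ∑ i, a i * Complex.normSq (x i) := by
  simp only [dotProduct, Matrix.mulVec_diagonal, Complex.re_sum, Pi.star_apply]
  refine Finset.sum_congr rfl fun i _ => ?_
  rw [mul_left_comm, show star (x i) * x i = (Complex.normSq (x i) : ℂ) from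
    Complex.normSq_eq_conj_mul_self.symm, ← Complex.ofReal_mul, Complex.ofReal_re]

theorem dotProduct_conj_diagonal_mulVec [DecidableEq ι] (U : Matrix κ ι ℂ) (a : ι → ℝ)
    (x : κ → ℂ) :
    (star x ⬝ᵥ (U * (Matrix.diagonal fun i => (a i : ℂ)) * Uᴴ) *ᵥ x).re =
      ∑ i, a i * Complex.normSq ((Uᴴ *ᵥ x) i) := by
  rw [← dotProduct_diagonal_mulVec, Matrix.star_mulVec, Matrix.conjTranspose_conjTranspose,
    ← Matrix.dotProduct_mulVec, Matrix.mulVec_mulVec, Matrix.mulVec_mulVec, Matrix.mul_assoc]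

theorem abs_re_dotProduct_mulVec_le (A : Matrix ι ι ℂ) (x : ι → ℂ) :
    |(star x ⬝ᵥ A *ᵥ x).re| ≤ (∑ i, ∑ j, ‖A i j‖) * sqNorm x := by
  have hx : ∀ i, ‖x i‖ ^ 2 ≤ sqNorm x := fun i => by
    rw [← Complex.normSq_eq_norm_sq]
    exact Finset.single_le_sum (f := fun i => Complex.normSq (x i))
      (fun _ _ => Complex.normSq_nonneg _) (Finset.mem_univ i)
  refine (Complex.abs_re_le_norm _).trans ?_
  simp only [dotProduct, Matrix.mulVec, Pi.star_apply, Finset.mul_sum, Finset.sum_mul]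
  refine (norm_sum_le _ _).trans (Finset.sum_le_sum fun i _ => (norm_sum_le _ _).trans
    (Finset.sum_le_sum fun j _ => ?_))
  rw [norm_mul, norm_mul, norm_star]
  have : ‖x i‖ * ‖x j‖ ≤ sqNorm x := by nlinarith [hx i, hx j, sq_nonneg (‖x i‖ - ‖x j‖)]
  nlinarith [norm_nonneg (A i j)]

end SqNorm

/-- A form of the Courant–Fischer min-max principle: comparison of two diagonal quadratic forms
along an isometry. -/
theorem le_add_of_forall_sum_le {m j : ℕ} (hj : j ≤ m) {T : Matrix (Fin m) (Fin j) ℂ}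
    (hT : Tᴴ * T = 1) {μ : Fin j → ℝ} {l : Fin m → ℝ} (hμ : Antitone μ) (hl : Antitone l) {ε : ℝ}
    (h : ∀ w : Fin j → ℂ, ∑ a, μ a * Complex.normSq (w a) ≤
      ∑ b, l b * Complex.normSq ((T *ᵥ w) b) + ε * sqNorm w) (i : Fin j) :
    μ i ≤ l (Fin.castLE hj i) + ε := by
  -- Dimension count as a singular matrix: the rows before `i` force the first coordinates of `T w`
  -- to vanish, the rows after `i` kill the later coordinates of `w`, and row `i` imposes nothing. A
  -- nonzero `w` in the kernel tests both forms at index `i`.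
  set G : Matrix (Fin j) (Fin j) ℂ := Matrix.of fun a =>
    if a < i then T (Fin.castLE hj a) else if a = i then 0 else (1 : Matrix _ _ ℂ) a with hG
  have hdet : G.det = 0 := Matrix.det_eq_zero_of_row_eq_zero i fun b => by simp [hG]
  obtain ⟨w, hw0, hw⟩ := Matrix.exists_mulVec_eq_zero_iff.2 hdet
  have h1 : ∀ a, a < i → (T *ᵥ w) (Fin.castLE hj a) = 0 := by
    intro a ha
    have := congrFun hw a
    simpa [hG, Matrix.mulVec, ha] using this
  have h2 : ∀ a, i < a → w a = 0 := by
    intro a ha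
    have := congrFun hw a
    rw [← Matrix.one_mulVec w]
    simpa only [hG, Matrix.mulVec, Matrix.of_apply, not_lt_of_gt ha, if_false, ha.ne',
      Pi.zero_apply] using this
  have hlow : μ i * sqNorm w ≤ ∑ a, μ a * Complex.normSq (w a) := by
    rw [sqNorm, Finset.mul_sum]
    refine Finset.sum_le_sum fun a _ => ?_
    rcases le_or_gt a i with hai | hai
    · exact mul_le_mul_of_nonneg_right (hμ hai) (Complex.normSq_nonneg _)
    · simp [h2 a hai]
  have hup : ∑ b, l b * Complex.normSq ((T *ᵥ w) b) ≤ l (Fin.castLE hj i) * sqNorm w := by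
    rw [← sqNorm_mulVec_of_isometry hT w, sqNorm, Finset.mul_sum]
    refine Finset.sum_le_sum fun b _ => ?_
    rcases le_or_gt (Fin.castLE hj i) b with hbi | hbi
    · exact mul_le_mul_of_nonneg_right (hl hbi) (Complex.normSq_nonneg _)
    · have hb : (b : ℕ) < i := hbi
      have := h1 ⟨b, hb.trans i.2⟩ hb
      rw [show Fin.castLE hj ⟨b, hb.trans i.2⟩ = b from rfl] at this
      simp [this]
  have hpos := sqNorm_pos hw0
  have := (hlow.trans (h w)).trans (add_le_add_left hup _)
  rw [← add_mul] at this
  exact le_of_mul_le_mul_right this hpos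

/-- The eigenvalues of a Hermitian matrix, in decreasing order. -/
noncomputable def sortedEig {m : ℕ} (A : Matrix (Fin m) (Fin m) ℂ) : Fin m → ℝ :=
  open Classical in if hA : A.IsHermitian then
    fun i => hA.eigenvalues₀ (Fin.cast (Fintype.card_fin m).symm i) else 0

theorem antitone_sortedEig {m : ℕ} (A : Matrix (Fin m) (Fin m) ℂ) : Antitone (sortedEig A) := by
  unfold sortedEig
  split_ifs with hA
  · exact fun i j hij => hA.eigenvalues₀_antitone (by simpa using hij)
  · exact antitone_const

/-- The spectral theorem and the functional calculus, with the eigenvalues in decreasing order. -/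
theorem exists_cfc_eq_conj_diagonal_sortedEig {m : ℕ} {A : Matrix (Fin m) (Fin m) ℂ}
    (hA : A.IsHermitian) : ∃ U : Matrix (Fin m) (Fin m) ℂ, Uᴴ * U = 1 ∧ U * Uᴴ = 1 ∧
      (A = U * (Matrix.diagonal fun i => (sortedEig A i : ℂ)) * Uᴴ) ∧
      ∀ f : ℝ → ℝ, cfc f A = U * (Matrix.diagonal fun i => (f (sortedEig A i) : ℂ)) * Uᴴ := by
  set e : Fin m ≃ Fin m := (Fintype.equivOfCardEq (Fintype.card_fin _)).symm.trans
    (finCongr (Fintype.card_fin m)) with he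
  have hev : ∀ i, hA.eigenvalues i = sortedEig A (e i) := by
    intro i
    rw [sortedEig, dif_pos hA]
    rfl
  set W : Matrix (Fin m) (Fin m) ℂ := (hA.eigenvectorUnitary : Matrix (Fin m) (Fin m) ℂ) with hW
  have hW1 : Wᴴ * W = 1 := Unitary.coe_star_mul_self hA.eigenvectorUnitary
  have hW2 : W * Wᴴ = 1 := Unitary.coe_mul_star_self hA.eigenvectorUnitary
  have hcfc : ∀ f : ℝ → ℝ,
      cfc f A = W * (Matrix.diagonal fun i => (f (hA.eigenvalues i) : ℂ)) * Wᴴ := fun f => by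
    rw [hA.cfc_eq]
    rfl
  have key : ∀ f : ℝ → ℝ, cfc f A = W.submatrix id e.symm *
      (Matrix.diagonal fun i => (f (sortedEig A i) : ℂ)) * (W.submatrix id e.symm)ᴴ := fun f => by
    have hD : (Matrix.diagonal fun i => (f (sortedEig A i) : ℂ)) =
        (Matrix.diagonal fun i => (f (hA.eigenvalues i) : ℂ)).submatrix e.symm e.symm := by
      rw [Matrix.submatrix_diagonal_equiv]
      congr 1
      ext i
      simp [hev]
    rw [hD, Matrix.conjTranspose_submatrix, Matrix.submatrix_mul_equiv,
      Matrix.submatrix_mul_equiv, ← hcfc, Matrix.submatrix_id_id]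
  refine ⟨W.submatrix id e.symm, ?_, ?_, ?_, key⟩
  · rw [Matrix.conjTranspose_submatrix, ← Matrix.submatrix_mul _ _ _ id _ Function.bijective_id, hW1,
      Matrix.submatrix_one_equiv]
  · rw [Matrix.conjTranspose_submatrix, Matrix.submatrix_mul_equiv, hW2, Matrix.submatrix_id_id]
  · have h := key fun x => x
    rwa [cfc_id' ℝ A hA.isSelfAdjoint] at h

theorem exists_eq_conj_diagonal_sortedEig {m : ℕ} {A : Matrix (Fin m) (Fin m) ℂ}
    (hA : A.IsHermitian) : ∃ U : Matrix (Fin m) (Fin m) ℂ, Uᴴ * U = 1 ∧ U * Uᴴ = 1 ∧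
      A = U * (Matrix.diagonal fun i => (sortedEig A i : ℂ)) * Uᴴ :=
  let ⟨U, h1, h2, h3, _⟩ := exists_cfc_eq_conj_diagonal_sortedEig hA
  ⟨U, h1, h2, h3⟩

/-- Comparison of the eigenvalues of two Hermitian matrices whose quadratic forms are comparable
along an isometry. -/
theorem sortedEig_le_of_forall_dotProduct_le {m j : ℕ} (hj : j ≤ m) {V : Matrix (Fin m) (Fin j) ℂ}
    (hV : Vᴴ * V = 1) {Q : Matrix (Fin j) (Fin j) ℂ} {P : Matrix (Fin m) (Fin m) ℂ}
    (hQ : Q.IsHermitian) (hP : P.IsHermitian) {ε : ℝ}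
    (h : ∀ w : Fin j → ℂ, (star w ⬝ᵥ Q *ᵥ w).re ≤
      (star (V *ᵥ w) ⬝ᵥ P *ᵥ (V *ᵥ w)).re + ε * sqNorm w) (i : Fin j) :
    sortedEig Q i ≤ sortedEig P (Fin.castLE hj i) + ε := by
  obtain ⟨W, hW1, hW2, hWQ⟩ := exists_eq_conj_diagonal_sortedEig hQ
  obtain ⟨U, hU1, hU2, hUP⟩ := exists_eq_conj_diagonal_sortedEig hP
  refine le_add_of_forall_sum_le hj (T := Uᴴ * V * W) ?_ (antitone_sortedEig Q)
    (antitone_sortedEig P) (fun w => ?_) i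
  · rw [Matrix.conjTranspose_mul, Matrix.conjTranspose_mul, Matrix.conjTranspose_conjTranspose]
    calc Wᴴ * (Vᴴ * U) * (Uᴴ * V * W) = Wᴴ * (Vᴴ * (U * Uᴴ) * V) * W := by
          simp only [Matrix.mul_assoc]
      _ = 1 := by rw [hU2, Matrix.mul_one, hV, Matrix.mul_one, hW1]
  · have h3 := h (W *ᵥ w)
    rw [hUP, hWQ, dotProduct_conj_diagonal_mulVec, dotProduct_conj_diagonal_mulVec,
      sqNorm_mulVec_of_isometry hW1, Matrix.mulVec_mulVec, hW1, Matrix.one_mulVec,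
      Matrix.mulVec_mulVec, Matrix.mulVec_mulVec] at h3
    exact h3

/-- A crude form of Weyl's perturbation bound, from min-max along the identity; it serves to prove
that ordered eigenvalues depend continuously on the matrix. -/
theorem sortedEig_sub_le {m : ℕ} {A B : Matrix (Fin m) (Fin m) ℂ} (hA : A.IsHermitian)
    (hB : B.IsHermitian) (i : Fin m) :
    sortedEig A i ≤ sortedEig B i + ∑ i, ∑ j, ‖A i j - B i j‖ := by
  refine sortedEig_le_of_forall_dotProduct_le le_rfl (V := 1) (by simp) hA hB (fun w => ?_) i
  have := (le_abs_self _).trans (abs_re_dotProduct_mulVec_le (A - B) w)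
  rw [Matrix.sub_mulVec, dotProduct_sub, Complex.sub_re] at this
  rw [Matrix.one_mulVec]
  simp only [Matrix.sub_apply] at this
  linarith

theorem continuous_sortedEig {X : Type*} [TopologicalSpace X] {m : ℕ}
    {A : X → Matrix (Fin m) (Fin m) ℂ} (hA : ∀ t, (A t).IsHermitian)
    (hc : ∀ i j, Continuous fun t => A t i j) (i : Fin m) :
    Continuous fun t => sortedEig (A t) i := by
  rw [continuous_iff_continuousAt]
  intro t₀
  have hlim : Tendsto (fun t => ∑ i, ∑ j, ‖A t i j - A t₀ i j‖) (𝓝 t₀) (𝓝 0) := by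
    have : Continuous fun t => ∑ i, ∑ j, ‖A t i j - A t₀ i j‖ := by fun_prop
    simpa using this.tendsto t₀
  rw [ContinuousAt, tendsto_iff_dist_tendsto_zero]
  refine squeeze_zero (fun _ => dist_nonneg) (fun t => ?_) hlim
  rw [Real.dist_eq, abs_sub_le_iff]
  have h1 := sortedEig_sub_le (hA t) (hA t₀) i
  have h2 := sortedEig_sub_le (hA t₀) (hA t) i
  simp only [norm_sub_rev (A t₀ _ _)] at h2
  constructor <;> linarith

theorem det_eq_prod_sortedEig {m : ℕ} {A : Matrix (Fin m) (Fin m) ℂ} (hA : A.IsHermitian) :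
    A.det = ∏ i, (sortedEig A i : ℂ) := by
  obtain ⟨U, hU1, hU2, hU⟩ := exists_eq_conj_diagonal_sortedEig hA
  conv_lhs => rw [hU]
  rw [Matrix.det_mul_right_comm, hU2, Matrix.one_mul, Matrix.det_diagonal]

theorem trace_eq_sum_sortedEig {m : ℕ} {A : Matrix (Fin m) (Fin m) ℂ} (hA : A.IsHermitian) :
    A.trace = ∑ i, (sortedEig A i : ℂ) := by
  obtain ⟨U, hU1, hU2, hU⟩ := exists_eq_conj_diagonal_sortedEig hA
  conv_lhs => rw [hU]
  rw [Matrix.trace_mul_comm, ← Matrix.mul_assoc, hU1, Matrix.one_mul, Matrix.trace_diagonal]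

theorem sortedEig_conjTranspose_mul_self_nonneg {m : ℕ} (F : Matrix (Fin m) (Fin m) ℂ)
    (i : Fin m) : 0 ≤ sortedEig (Fᴴ * F) i := by
  have hP := Matrix.isHermitian_conjTranspose_mul_self F
  obtain ⟨U, hU1, hU2, hU⟩ := exists_eq_conj_diagonal_sortedEig hP
  have := le_add_of_forall_sum_le le_rfl (T := Uᴴ) (by simpa using hU2) (μ := 0)
    (l := sortedEig (Fᴴ * F)) (ε := 0) antitone_const (antitone_sortedEig _) (fun w => by
      rw [← dotProduct_conj_diagonal_mulVec, ← hU, dotProduct_conjTranspose_mul_mulVec]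
      simpa using sqNorm_nonneg _) i
  simpa using this

theorem sortedEig_conjTranspose_mul_self_le {m : ℕ} {F : Matrix (Fin m) (Fin m) ℂ} {C : ℝ}
    (hF : ∀ x, sqNorm (F *ᵥ x) ≤ C * sqNorm x) (i : Fin m) : sortedEig (Fᴴ * F) i ≤ C := by
  have hP := Matrix.isHermitian_conjTranspose_mul_self F
  obtain ⟨U, hU1, hU2, hU⟩ := exists_eq_conj_diagonal_sortedEig hP
  have := le_add_of_forall_sum_le le_rfl (T := U) hU1 (l := 0)
    (μ := sortedEig (Fᴴ * F)) (ε := C) (antitone_sortedEig _) antitone_const (fun w => by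
      have h := hF (U *ᵥ w)
      have h2 := congrArg Complex.re (dotProduct_conjTranspose_mul_mulVec F (U *ᵥ w))
      rw [hU, dotProduct_conj_diagonal_mulVec, Matrix.mulVec_mulVec, hU1, Matrix.one_mulVec,
        Complex.ofReal_re] at h2
      rw [h2]
      rw [sqNorm_mulVec_of_isometry hU1] at h
      simpa using h) i
  simpa using this

/-- The determinant of a compression is bounded by the product of the largest singular values. -/
theorem norm_det_compression_sq_le {m j : ℕ} (hj : j ≤ m) {V : Matrix (Fin m) (Fin j) ℂ}
    (hV : Vᴴ * V = 1) (F : Matrix (Fin m) (Fin m) ℂ) :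
    ‖(Vᴴ * F * V).det‖ ^ 2 ≤ ∏ i : Fin j, sortedEig (Fᴴ * F) (Fin.castLE hj i) := by
  set M := Vᴴ * F * V with hM
  have hQ := Matrix.isHermitian_conjTranspose_mul_self M
  have hdet : ‖M.det‖ ^ 2 = ∏ i, sortedEig (Mᴴ * M) i := by
    have h := det_eq_prod_sortedEig hQ
    rw [Matrix.det_mul, Matrix.det_conjTranspose, ← Complex.ofReal_prod] at h
    rw [← Complex.ofReal_inj, ← h, ← Complex.normSq_eq_norm_sq]
    exact Complex.normSq_eq_conj_mul_self
  rw [hdet]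
  refine Finset.prod_le_prod (fun i _ => sortedEig_conjTranspose_mul_self_nonneg M i) fun i _ => ?_
  have := sortedEig_le_of_forall_dotProduct_le hj hV hQ
    (Matrix.isHermitian_conjTranspose_mul_self F) (ε := 0) (fun w => by
      rw [dotProduct_conjTranspose_mul_mulVec, dotProduct_conjTranspose_mul_mulVec,
        Complex.ofReal_re, Complex.ofReal_re, zero_mul, add_zero, hM, ← Matrix.mulVec_mulVec,
        ← Matrix.mulVec_mulVec]
      exact sqNorm_conjTranspose_mulVec_le hV _) i
  simpa using this

end TProd

/-! ### Products of complex exponentials and the logarithmic majorization. -/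

namespace TProd

open Filter Topology MeasureTheory Metric
open scoped Matrix

section Det

variable {n : Type*} [Fintype n] [DecidableEq n]

theorem differentiable_det {M : ℂ → Matrix n n ℂ}
    (hM : ∀ i j, Differentiable ℂ fun z => M z i j) : Differentiable ℂ fun z => (M z).det := by
  simp only [Matrix.det_apply]
  refine Differentiable.fun_sum fun σ _ => Differentiable.const_smul ?_ _
  exact Differentiable.fun_finsetProd fun i _ => hM _ _

/-- A permutation other than the identity moves at least two indices. After one factor of its
product has been differentiated, an off-diagonal entry of `1` is still left, so only the identity
contributes, and it gives the trace. -/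
theorem hasDerivAt_det_of_eq_one {M : ℂ → Matrix n n ℂ} {M' : Matrix n n ℂ} {z₀ : ℂ}
    (hM : ∀ i j, HasDerivAt (fun z => M z i j) (M' i j) z₀) (h1 : M z₀ = 1) :
    HasDerivAt (fun z => (M z).det) M'.trace z₀ := by
  simp only [Matrix.det_apply]
  have key : ∀ σ : Equiv.Perm n, HasDerivAt
      (fun z => Equiv.Perm.sign σ • ∏ i, M z (σ i) i) (if σ = 1 then M'.trace else 0) z₀ := by
    intro σ
    have h := (HasDerivAt.fun_finsetProd (u := Finset.univ) (f := fun i z => M z (σ i) i)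
      fun i _ => hM (σ i) i).const_smul (Equiv.Perm.sign σ)
    refine h.congr_deriv ?_
    split_ifs with hσ
    · subst hσ
      simp [h1, Matrix.trace]
    · rw [smul_eq_zero_iff_eq]
      refine Finset.sum_eq_zero fun i _ => ?_
      obtain ⟨l, hl, hli⟩ : ∃ l, σ l ≠ l ∧ l ≠ i := by
        obtain ⟨l, hl⟩ : ∃ l, σ l ≠ l := by
          by_contra! hc
          exact hσ (Equiv.ext hc)
        rcases eq_or_ne l i with rfl | hli
        · exact ⟨σ l, fun hc => hl (σ.injective hc), hl⟩
        · exact ⟨l, hl, hli⟩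
      rw [Finset.prod_eq_zero (Finset.mem_erase.2 ⟨hli, Finset.mem_univ l⟩), zero_smul]
      simp [h1, Matrix.one_apply_ne hl]
  have h := HasDerivAt.fun_sum fun σ (_ : σ ∈ Finset.univ) => key σ
  simpa using h

end Det

variable {m : ℕ}

theorem exp_smul_conj_diagonal {U : Matrix (Fin m) (Fin m) ℂ} (hU1 : Uᴴ * U = 1)
    (hU2 : U * Uᴴ = 1) (a : Fin m → ℂ) (z : ℂ) :
    NormedSpace.exp (z • (U * Matrix.diagonal a * Uᴴ)) =
      U * (Matrix.diagonal fun i => Complex.exp (z * a i)) * Uᴴ := by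
  have hinv : U⁻¹ = Uᴴ := Matrix.inv_eq_left_inv hU1
  have hunit : IsUnit U := IsUnit.of_mul_eq_one _ hU2
  rw [← Matrix.smul_mul, ← Matrix.mul_smul, ← Matrix.diagonal_smul, ← hinv,
    Matrix.exp_conj _ _ hunit, Matrix.exp_diagonal]
  congr 3
  ext i
  rw [Pi.coe_exp, Complex.exp_eq_exp_ℂ]
  rfl

theorem exists_exp_smul_eq_conj_diagonal {A : Matrix (Fin m) (Fin m) ℂ} (hA : A.IsHermitian) :
    ∃ U : Matrix (Fin m) (Fin m) ℂ, Uᴴ * U = 1 ∧ U * Uᴴ = 1 ∧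
      (A = U * (Matrix.diagonal fun i => (sortedEig A i : ℂ)) * Uᴴ) ∧
      ∀ z : ℂ, NormedSpace.exp (z • A) =
        U * (Matrix.diagonal fun i => Complex.exp (z * sortedEig A i)) * Uᴴ := by
  obtain ⟨U, hU1, hU2, hU⟩ := exists_eq_conj_diagonal_sortedEig hA
  refine ⟨U, hU1, hU2, hU, fun z => ?_⟩
  conv_lhs => rw [hU]
  exact exp_smul_conj_diagonal hU1 hU2 _ z

theorem exp_eq_cfc_real_exp {A : Matrix (Fin m) (Fin m) ℂ} (hA : A.IsHermitian) :
    NormedSpace.exp A = cfc Real.exp A := by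
  obtain ⟨U, hU1, hU2, hU, hf⟩ := exists_cfc_eq_conj_diagonal_sortedEig hA
  have h := exp_smul_conj_diagonal hU1 hU2 (fun i => (sortedEig A i : ℂ)) 1
  rw [← hU, one_smul] at h
  rw [h, hf]
  simp only [one_mul, Complex.ofReal_exp]

/-- Every entry is a finite combination of scalar exponentials in `z`, which makes holomorphy and
derivatives elementary. -/
theorem exp_smul_apply_eq_sum {A : Matrix (Fin m) (Fin m) ℂ} (hA : A.IsHermitian) :
    ∃ U : Matrix (Fin m) (Fin m) ℂ,
      (∀ i j, A i j = ∑ b, U i b * sortedEig A b * star (U j b)) ∧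
      ∀ (z : ℂ) i j, NormedSpace.exp (z • A) i j =
        ∑ b, U i b * Complex.exp (z * sortedEig A b) * star (U j b) := by
  obtain ⟨U, hU1, hU2, hU, hexp⟩ := exists_exp_smul_eq_conj_diagonal hA
  refine ⟨U, fun i j => ?_, fun z i j => ?_⟩
  · conv_lhs => rw [hU]
    simp only [Matrix.mul_apply (M := U * _), Matrix.mul_diagonal, Matrix.conjTranspose_apply]
  · rw [hexp]
    simp only [Matrix.mul_apply (M := U * _), Matrix.mul_diagonal, Matrix.conjTranspose_apply]

/-- The product of the exponentials `exp (z • A)` along a list of matrices. -/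
noncomputable def expProd (L : List (Matrix (Fin m) (Fin m) ℂ)) (z : ℂ) :
    Matrix (Fin m) (Fin m) ℂ :=
  (L.map fun A => NormedSpace.exp (z • A)).prod

theorem expProd_cons (A : Matrix (Fin m) (Fin m) ℂ) (L : List (Matrix (Fin m) (Fin m) ℂ)) (z : ℂ) :
    expProd (A :: L) z = NormedSpace.exp (z • A) * expProd L z := by
  simp [expProd]

theorem expProd_zero (L : List (Matrix (Fin m) (Fin m) ℂ)) : expProd L 0 = 1 := by
  induction L with
  | nil => simp [expProd]
  | cons A L ih => rw [expProd_cons, ih, zero_smul, NormedSpace.exp_zero, mul_one]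

theorem differentiable_expProd {L : List (Matrix (Fin m) (Fin m) ℂ)}
    (hL : ∀ A ∈ L, A.IsHermitian) (i j : Fin m) : Differentiable ℂ fun z => expProd L z i j := by
  induction L generalizing i j with
  | nil => simp [expProd]
  | cons A L ih =>
    obtain ⟨U, hU, hexp⟩ := exp_smul_apply_eq_sum (hL A (by simp))
    have ih' := ih fun B hB => hL B (by simp [hB])
    simp only [expProd_cons, Matrix.mul_apply, hexp]
    fun_prop

theorem hasDerivAt_expProd {L : List (Matrix (Fin m) (Fin m) ℂ)}
    (hL : ∀ A ∈ L, A.IsHermitian) (i j : Fin m) :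
    HasDerivAt (fun z => expProd L z i j) (L.sum i j) 0 := by
  induction L generalizing i j with
  | nil => simpa [expProd] using hasDerivAt_const (0 : ℂ) ((1 : Matrix (Fin m) (Fin m) ℂ) i j)
  | cons A L ih =>
    obtain ⟨U, hU, hexp⟩ := exp_smul_apply_eq_sum (hL A (by simp))
    have hAd : ∀ i j, HasDerivAt (fun z : ℂ => NormedSpace.exp (z • A) i j) (A i j) 0 := by
      intro i j
      simp only [hexp, hU]
      refine HasDerivAt.fun_sum fun b _ => HasDerivAt.mul_const (HasDerivAt.const_mul _ ?_) _
      simpa using ((hasDerivAt_id (0 : ℂ)).mul_const (sortedEig A b : ℂ)).cexp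
    have ih' := ih fun B hB => hL B (by simp [hB])
    simp only [expProd_cons, Matrix.mul_apply]
    refine (HasDerivAt.fun_sum fun k (_ : k ∈ Finset.univ) =>
      (hAd i k).mul (ih' k j)).congr_deriv ?_
    rw [expProd_zero, zero_smul, NormedSpace.exp_zero, List.sum_cons, Finset.sum_add_distrib]
    simp [Matrix.one_apply, Matrix.add_apply]

theorem det_expProd {L : List (Matrix (Fin m) (Fin m) ℂ)} (hL : ∀ A ∈ L, A.IsHermitian) (z : ℂ) :
    (expProd L z).det = Complex.exp (z * L.sum.trace) := by
  induction L with
  | nil => simp [expProd]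
  | cons A L ih =>
    obtain ⟨U, hU1, hU2, hU, hexp⟩ := exists_exp_smul_eq_conj_diagonal (hL A (by simp))
    rw [expProd_cons, Matrix.det_mul, ih fun B hB => hL B (by simp [hB]), hexp,
      Matrix.det_mul_right_comm, hU2, Matrix.one_mul, Matrix.det_diagonal, List.sum_cons,
      Matrix.trace_add, mul_add, Complex.exp_add, ← Complex.exp_sum, ← Finset.mul_sum,
      trace_eq_sum_sortedEig (hL A (by simp))]

/-- The imaginary part of `z` contributes only phases in an eigenbasis, so the bound depends on
`z.re` alone. It gives contractions on the imaginary axis and uniform bounds on the strip. -/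
theorem exists_sqNorm_expProd_mulVec_le {L : List (Matrix (Fin m) (Fin m) ℂ)}
    (hL : ∀ A ∈ L, A.IsHermitian) : ∃ c : ℝ, 0 ≤ c ∧ ∀ (z : ℂ) (x : Fin m → ℂ),
      sqNorm (expProd L z *ᵥ x) ≤ Real.exp (|z.re| * c) * sqNorm x := by
  induction L with
  | nil => exact ⟨0, le_rfl, fun z x => by simp [expProd]⟩
  | cons A L ih =>
    obtain ⟨c, hc0, hc⟩ := ih fun B hB => hL B (by simp [hB])
    obtain ⟨U, hU1, hU2, hU, hexp⟩ := exists_exp_smul_eq_conj_diagonal (hL A (by simp))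
    -- The factor `2` appears because `sqNorm` is the square of the norm.
    set d := ∑ i, 2 * |sortedEig A i| with hd
    have hd0 : 0 ≤ d := Finset.sum_nonneg fun _ _ => by positivity
    refine ⟨d + c, by positivity, fun z x => ?_⟩
    have hA : ∀ x, sqNorm (NormedSpace.exp (z • A) *ᵥ x) ≤ Real.exp (|z.re| * d) * sqNorm x := by
      intro x
      have hx : sqNorm (Uᴴ *ᵥ x) = sqNorm x :=
        sqNorm_mulVec_of_isometry (V := Uᴴ) (by simpa using hU2) x
      rw [hexp, ← Matrix.mulVec_mulVec, ← Matrix.mulVec_mulVec, sqNorm_mulVec_of_isometry hU1, ← hx,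
        sqNorm, sqNorm, Finset.mul_sum]
      refine Finset.sum_le_sum fun i _ => ?_
      rw [Matrix.mulVec_diagonal, Complex.normSq_mul]
      refine mul_le_mul_of_nonneg_right ?_ (Complex.normSq_nonneg _)
      rw [Complex.normSq_eq_norm_sq, Complex.norm_exp, ← Real.exp_nat_mul, Real.exp_le_exp,
        Complex.re_mul_ofReal]
      have h1 : 2 * |sortedEig A i| ≤ d :=
        Finset.single_le_sum (f := fun i => 2 * |sortedEig A i|) (fun _ _ => by positivity)
          (Finset.mem_univ i)
      calc ((2 : ℕ) : ℝ) * (z.re * sortedEig A i) ≤ 2 * |z.re * sortedEig A i| := by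
            push_cast
            exact mul_le_mul_of_nonneg_left (le_abs_self _) zero_le_two
        _ = |z.re| * (2 * |sortedEig A i|) := by rw [abs_mul]; ring
        _ ≤ |z.re| * d := mul_le_mul_of_nonneg_left h1 (abs_nonneg _)
    rw [expProd_cons, ← Matrix.mulVec_mulVec, mul_add, Real.exp_add, mul_assoc]
    exact (hA _).trans (mul_le_mul_of_nonneg_left (hc z x) (Real.exp_pos _).le)

/-- The logarithms of the singular values of a matrix, in decreasing order. -/
noncomputable def logSingularValues (F : Matrix (Fin m) (Fin m) ℂ) (i : Fin m) : ℝ :=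
  Real.log (sortedEig (Fᴴ * F) i) / 2

theorem sortedEig_conjTranspose_mul_self_pos {F : Matrix (Fin m) (Fin m) ℂ} (hF : F.det ≠ 0)
    (i : Fin m) : 0 < sortedEig (Fᴴ * F) i := by
  refine lt_of_le_of_ne (sortedEig_conjTranspose_mul_self_nonneg F i) fun h => ?_
  have hdet := det_eq_prod_sortedEig (Matrix.isHermitian_conjTranspose_mul_self F)
  rw [Finset.prod_eq_zero (Finset.mem_univ i) (by rw [← h, Complex.ofReal_zero]), Matrix.det_mul,
    Matrix.det_conjTranspose] at hdet
  simp [hF] at hdet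

theorem det_expProd_ne_zero {L : List (Matrix (Fin m) (Fin m) ℂ)} (hL : ∀ A ∈ L, A.IsHermitian)
    (z : ℂ) : (expProd L z).det ≠ 0 := by
  rw [det_expProd hL]
  exact Complex.exp_ne_zero _

theorem isHermitian_list_sum {L : List (Matrix (Fin m) (Fin m) ℂ)} (hL : ∀ A ∈ L, A.IsHermitian) :
    L.sum.IsHermitian := by
  induction L with
  | nil => simp
  | cons A L ih =>
    rw [List.sum_cons]
    exact (hL A (by simp)).add (ih fun B hB => hL B (by simp [hB]))

/-- The trace of the Hermitian sum is real, so `|det F(1 + it)| = exp (tr H)` for all `t`. This is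
the equality of total sums that majorization requires. -/
theorem sum_logSingularValues_expProd {L : List (Matrix (Fin m) (Fin m) ℂ)}
    (hL : ∀ A ∈ L, A.IsHermitian) (t : ℝ) :
    ∑ i, logSingularValues (expProd L (1 + Complex.I * t)) i = ∑ i, sortedEig L.sum i := by
  set F := expProd L (1 + Complex.I * t) with hF
  have hdet : F.det ≠ 0 := det_expProd_ne_zero hL _
  have h1 : ∏ i, sortedEig (Fᴴ * F) i = Real.exp (∑ i, sortedEig L.sum i) ^ 2 := by
    have h := det_eq_prod_sortedEig (Matrix.isHermitian_conjTranspose_mul_self F)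
    rw [Matrix.det_mul, Matrix.det_conjTranspose, ← Complex.ofReal_prod] at h
    have h2 : star F.det * F.det = ((‖F.det‖ ^ 2 : ℝ) : ℂ) := by
      rw [← Complex.normSq_eq_norm_sq]
      exact Complex.normSq_eq_conj_mul_self.symm
    rw [h2, Complex.ofReal_inj] at h
    rw [← h, hF, det_expProd hL, Complex.norm_exp,
      trace_eq_sum_sortedEig (isHermitian_list_sum hL), ← Complex.ofReal_sum]
    simp
  simp only [logSingularValues, ← Finset.sum_div]
  rw [← Real.log_prod fun i _ => (sortedEig_conjTranspose_mul_self_pos hdet i).ne', h1,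
    Real.log_pow, Real.log_exp]
  push_cast
  ring

theorem continuous_expProd {L : List (Matrix (Fin m) (Fin m) ℂ)} (hL : ∀ A ∈ L, A.IsHermitian)
    (i j : Fin m) : Continuous fun t : ℝ => expProd L (1 + Complex.I * t) i j :=
  (differentiable_expProd hL i j).continuous.comp (by fun_prop)

theorem continuous_logSingularValues_expProd {L : List (Matrix (Fin m) (Fin m) ℂ)}
    (hL : ∀ A ∈ L, A.IsHermitian) (i : Fin m) :
    Continuous fun t : ℝ => logSingularValues (expProd L (1 + Complex.I * t)) i := by
  refine Continuous.div_const (Continuous.log ?_ fun t =>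
    (sortedEig_conjTranspose_mul_self_pos (det_expProd_ne_zero hL _) i).ne') _
  refine continuous_sortedEig (fun t => Matrix.isHermitian_conjTranspose_mul_self _)
    (fun a b => ?_) i
  have := continuous_expProd hL
  simp only [Matrix.mul_apply, Matrix.conjTranspose_apply]
  fun_prop

/-- The norm bound gives the upper estimate. The lower one follows because the sum over all indices
is constant in `t` while the other terms are bounded above. -/
theorem exists_abs_logSingularValues_expProd_le {L : List (Matrix (Fin m) (Fin m) ℂ)}
    (hL : ∀ A ∈ L, A.IsHermitian) : ∃ K : ℝ, ∀ (t : ℝ) (i : Fin m),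
      |logSingularValues (expProd L (1 + Complex.I * t)) i| ≤ K := by
  obtain ⟨c, hc0, hc⟩ := exists_sqNorm_expProd_mulVec_le hL
  have hup : ∀ (t : ℝ) (i : Fin m), logSingularValues (expProd L (1 + Complex.I * t)) i ≤ c := by
    intro t i
    have h := sortedEig_conjTranspose_mul_self_le (hc (1 + Complex.I * t)) i
    have h2 := Real.log_le_log (sortedEig_conjTranspose_mul_self_pos (det_expProd_ne_zero hL _) i) h
    simp only [Real.log_exp, Complex.add_re, Complex.one_re, Complex.mul_re, Complex.I_re,
      Complex.I_im, Complex.ofReal_im, Complex.ofReal_re, zero_mul, mul_zero, sub_zero, add_zero,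
      abs_one, one_mul] at h2
    rw [logSingularValues]
    linarith
  refine ⟨|∑ i, sortedEig L.sum i| + m * c, fun t i => ?_⟩
  have hm : (1 : ℝ) ≤ m := by
    exact_mod_cast (Nat.one_le_iff_ne_zero.2 (by rintro rfl; exact i.elim0))
  have hsum := sum_logSingularValues_expProd hL t
  rw [← Finset.add_sum_erase _ _ (Finset.mem_univ i)] at hsum
  have hrest : ∑ l ∈ Finset.univ.erase i, logSingularValues (expProd L (1 + Complex.I * t)) l ≤
      m * c := by
    refine (Finset.sum_le_card_nsmul _ _ c fun l _ => hup t l).trans ?_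
    rw [nsmul_eq_mul]
    refine mul_le_mul_of_nonneg_right ?_ hc0
    exact_mod_cast (Finset.card_le_univ _).trans (by simp)
  rw [abs_le]
  constructor
  · linarith [neg_abs_le (∑ i, sortedEig L.sum i)]
  · nlinarith [hup t i, abs_nonneg (∑ i, sortedEig L.sum i)]

/-- The logarithmic majorization underlying the multivariate Golden–Thompson inequality. -/
theorem sum_sortedEig_le_integral {L : List (Matrix (Fin m) (Fin m) ℂ)}
    (hL : ∀ A ∈ L, A.IsHermitian) {j : ℕ} (hj : j ≤ m) :
    ∑ i : Fin j, sortedEig L.sum (Fin.castLE hj i) ≤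
      ∫ t : ℝ, (∑ i : Fin j, logSingularValues (expProd L (1 + Complex.I * t)) (Fin.castLE hj i)) *
        beta0 t := by
  have hH := isHermitian_list_sum hL
  obtain ⟨U, hU1, hU2, hU⟩ := exists_eq_conj_diagonal_sortedEig hH
  obtain ⟨c, hc0, hc⟩ := exists_sqNorm_expProd_mulVec_le hL
  obtain ⟨K, hK⟩ := exists_abs_logSingularValues_expProd_le hL
  set V : Matrix (Fin m) (Fin j) ℂ := U.submatrix id (Fin.castLE hj) with hVdef
  have hV : Vᴴ * V = 1 := by
    rw [hVdef, Matrix.conjTranspose_submatrix, ← Matrix.submatrix_mul _ _ _ id _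
      Function.bijective_id, hU1, Matrix.submatrix_one _ (Fin.castLE_injective hj)]
  have hVH : (Vᴴ * L.sum * V).trace =
      ((∑ i : Fin j, sortedEig L.sum (Fin.castLE hj i) : ℝ) : ℂ) := by
    have e : Vᴴ * L.sum * V = (Uᴴ * L.sum * U).submatrix (Fin.castLE hj) (Fin.castLE hj) := by
      rw [hVdef, Matrix.conjTranspose_submatrix]
      ext a b
      simp [Matrix.mul_apply]
    have e2 : Uᴴ * L.sum * U = Matrix.diagonal fun i => (sortedEig L.sum i : ℂ) := by
      conv_lhs => rw [hU]
      calc Uᴴ * (U * (Matrix.diagonal fun i => (sortedEig L.sum i : ℂ)) * Uᴴ) * U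
          = (Uᴴ * U) * (Matrix.diagonal fun i => (sortedEig L.sum i : ℂ)) * (Uᴴ * U) := by
            simp only [Matrix.mul_assoc]
        _ = _ := by rw [hU1, Matrix.one_mul, Matrix.mul_one]
    rw [e, e2]
    simp [Matrix.trace]
  have hbound : ∀ z, ‖(Vᴴ * expProd L z * V).det‖ ^ 2 ≤ Real.exp (|z.re| * c) ^ j := by
    intro z
    refine (norm_det_compression_sq_le hj hV _).trans ?_
    refine (Finset.prod_le_prod (fun i _ => sortedEig_conjTranspose_mul_self_nonneg _ _)
      fun i _ => sortedEig_conjTranspose_mul_self_le (hc z) _).trans_eq ?_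
    simp
  have hentry : ∀ z a b, (Vᴴ * expProd L z * V) a b =
      ∑ k, (∑ l, Vᴴ a l * expProd L z l k) * V k b := fun z a b => by
    simp only [Matrix.mul_apply]
  have key := re_deriv_le_integral_mul_beta0 (h := fun z => (Vᴴ * expProd L z * V).det)
    (h' := (Vᴴ * L.sum * V).trace)
    (B := fun t => ∑ i : Fin j, logSingularValues (expProd L (1 + Complex.I * t)) (Fin.castLE hj i))
    (M := Real.exp c ^ j) (K := j * K) ?_ ?_ ?_ ?_ ?_ ?_ ?_ ?_
  · rwa [hVH, Complex.ofReal_re] at key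
  · refine differentiable_det fun a b => ?_
    have := differentiable_expProd hL
    simp only [hentry]
    fun_prop
  · intro z hz0 hz1
    have h1 : Real.exp (|z.re| * c) ^ j ≤ Real.exp c ^ j := by
      refine pow_le_pow_left₀ (Real.exp_pos _).le (Real.exp_le_exp.2 ?_) j
      rw [abs_of_nonneg hz0]
      nlinarith
    -- `hbound` controls `‖h‖ ^ 2` by `M`; as `M ≥ 1`, also `M ≤ M ^ 2`, so `M` bounds `‖h‖` itself.
    have h2 : 1 ≤ Real.exp c ^ j := one_le_pow₀ (Real.one_le_exp hc0)
    have h3 := (hbound z).trans h1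
    refine abs_le_of_sq_le_sq' (h3.trans ?_) (by positivity) |>.2
    nlinarith
  · intro t
    have h3 := hbound (Complex.I * t)
    simp only [Complex.mul_re, Complex.I_re, Complex.I_im, Complex.ofReal_im, zero_mul, mul_zero,
      sub_zero, abs_zero, Real.exp_zero, one_pow] at h3
    exact abs_le_of_sq_le_sq' (by simpa using h3) zero_le_one |>.2
  · intro t
    have h3 := norm_det_compression_sq_le hj hV (expProd L (1 + Complex.I * t))
    refine abs_le_of_sq_le_sq' (h3.trans_eq ?_) (Real.exp_pos _).le |>.2
    rw [← Real.exp_nat_mul, Finset.mul_sum, Real.exp_sum]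
    refine Finset.prod_congr rfl fun i _ => ?_
    rw [logSingularValues, Nat.cast_ofNat, mul_div_cancel₀ _ two_ne_zero,
      Real.exp_log (sortedEig_conjTranspose_mul_self_pos (det_expProd_ne_zero hL _) _)]
  · exact continuous_finsetSum _ fun i _ => continuous_logSingularValues_expProd hL _
  · intro t
    refine (Finset.abs_sum_le_sum_abs _ _).trans ?_
    refine (Finset.sum_le_card_nsmul _ _ K fun i _ => hK t _).trans ?_
    simp
  · simp [expProd_zero, hV]
  · refine hasDerivAt_det_of_eq_one (fun a b => ?_) (by rw [expProd_zero, Matrix.mul_one, hV])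
    have := hasDerivAt_expProd hL
    simp only [hentry]
    simp only [Matrix.mul_apply]
    exact HasDerivAt.fun_sum fun k _ => HasDerivAt.mul_const
      (HasDerivAt.fun_sum fun l _ => (this l k).const_mul _) _

end TProd

/-! ### Gauge functions of blockwise unitarily invariant norms. -/

namespace TProd

open Filter Topology MeasureTheory Metric
open scoped Matrix

variable {m p : ℕ}

/-- Invariance of a seminorm on `M_m(ℂ)^p` under multiplication by unitaries. -/
structure IsBlockUnitarilyInvariant (N : Seminorm ℂ (Fin p → Matrix (Fin m) (Fin m) ℂ)) :
    Prop where
  map_mul : ∀ D U : Fin p → Matrix (Fin m) (Fin m) ℂ, (∀ k, (U k)ᴴ * U k = 1) →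
    (∀ k, U k * (U k)ᴴ = 1) → N (fun k => D k * U k) = N D
  map_mul' : ∀ D U : Fin p → Matrix (Fin m) (Fin m) ℂ, (∀ k, (U k)ᴴ * U k = 1) →
    (∀ k, U k * (U k)ᴴ = 1) → N (fun k => U k * D k) = N D

/-- The gauge function of a unitarily invariant norm. -/
noncomputable def gauge (N : Seminorm ℂ (Fin p → Matrix (Fin m) (Fin m) ℂ))
    (v : Fin p → Fin m → ℝ) : ℝ :=
  N fun k => Matrix.diagonal fun i => (v k i : ℂ)

section Gauge

variable {N : Seminorm ℂ (Fin p → Matrix (Fin m) (Fin m) ℂ)}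

theorem gauge_nonneg (v : Fin p → Fin m → ℝ) : 0 ≤ gauge N v := apply_nonneg N _

theorem gauge_add_le (u v : Fin p → Fin m → ℝ) : gauge N (u + v) ≤ gauge N u + gauge N v := by
  refine le_trans (le_of_eq ?_) (map_add_le_add N _ _)
  simp only [gauge]
  congr 1
  ext k : 1
  simp

theorem gauge_smul (c : ℝ) (v : Fin p → Fin m → ℝ) : gauge N (c • v) = |c| * gauge N v := by
  rw [← Real.norm_eq_abs, ← Complex.norm_real, gauge, gauge, ← map_smul_eq_mul N (c : ℂ)]
  congr 1
  ext k a b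
  by_cases h : a = b <;> simp [h]

theorem convexOn_gauge : ConvexOn ℝ Set.univ (gauge N) := by
  refine ⟨convex_univ, fun u _ v _ a b ha hb _ => (gauge_add_le _ _).trans_eq ?_⟩
  rw [gauge_smul, gauge_smul, abs_of_nonneg ha, abs_of_nonneg hb, smul_eq_mul, smul_eq_mul]

theorem gauge_pos (hN0 : ∀ D, N D = 0 → D = 0) {v : Fin p → Fin m → ℝ} (hv : v ≠ 0) :
    0 < gauge N v := by
  refine lt_of_le_of_ne (gauge_nonneg v) fun h => hv ?_
  have := hN0 _ h.symm
  ext k i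
  have h2 := congrFun (congrFun (congrFun this k) i) i
  simpa using h2

theorem gauge_comp_eq_zero {N : Seminorm ℂ (Fin p → Matrix (Fin m) (Fin m) ℂ)} {ψ : ℝ → ℝ}
    (h : m = 0 ∨ ∀ x, ψ x = 0) (v : Fin p → Fin m → ℝ) :
    gauge N (fun k i => ψ (v k i)) = 0 := by
  have hz : (fun k => Matrix.diagonal fun i => (ψ (v k i) : ℂ)) =
      (0 : Fin p → Matrix (Fin m) (Fin m) ℂ) := by
    rcases h with rfl | h
    · exact Subsingleton.elim _ _
    · ext k : 1
      simp [h]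
  rw [gauge, hz, map_zero]

namespace IsBlockUnitarilyInvariant

theorem map_conj (hN : IsBlockUnitarilyInvariant N)
    {D U : Fin p → Matrix (Fin m) (Fin m) ℂ} (h1 : ∀ k, (U k)ᴴ * U k = 1)
    (h2 : ∀ k, U k * (U k)ᴴ = 1) : N (fun k => U k * D k * (U k)ᴴ) = N D := by
  rw [hN.map_mul (fun k => U k * D k) (fun k => (U k)ᴴ) (by simpa using h2) (by simpa using h1),
    hN.map_mul' D U h1 h2]

/-- Conjugation by permutation matrices, chosen separately in each block, permutes the diagonals. -/
theorem gauge_comp_perm (hN : IsBlockUnitarilyInvariant N)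
    (σ : Fin p → Equiv.Perm (Fin m)) (v : Fin p → Fin m → ℝ) :
    gauge N (fun k i => v k (σ k i)) = gauge N v := by
  have h2 : ∀ k, (1 : Matrix (Fin m) (Fin m) ℂ).submatrix (σ k) id *
      ((1 : Matrix (Fin m) (Fin m) ℂ).submatrix (σ k) id)ᴴ = 1 := fun k => by
    ext a b
    simp [Matrix.mul_apply, Matrix.one_apply]
  refine Eq.trans ?_ (hN.map_conj (fun k => mul_eq_one_comm.1 (h2 k)) h2)
  rw [gauge]
  congr 1
  ext k a b
  by_cases h : a = b <;> simp [Matrix.mul_apply, Matrix.one_apply, Matrix.diagonal_apply, h]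

theorem gauge_sign (hN : IsBlockUnitarilyInvariant N)
    {s v : Fin p → Fin m → ℝ} (h : ∀ k i, s k i = -v k i ∨ s k i = v k i) :
    gauge N s = gauge N v := by
  have hε : ∀ k i, ∃ ε : ℝ, ε * ε = 1 ∧ s k i = ε * v k i := fun k i => by
    rcases h k i with h | h
    · exact ⟨-1, by norm_num, by rw [h]; ring⟩
    · exact ⟨1, by norm_num, by rw [h]; ring⟩
  choose ε hε1 hε2 using hε
  have hD : ∀ k, (Matrix.diagonal fun i => (ε k i : ℂ)) * (Matrix.diagonal fun i => (ε k i : ℂ)) =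
      1 := fun k => by
    rw [Matrix.diagonal_mul_diagonal, ← Matrix.diagonal_one]
    congr 1
    ext i
    rw [← Complex.ofReal_mul, hε1, Complex.ofReal_one]
  have hs : ∀ k, (Matrix.diagonal fun i => (ε k i : ℂ))ᴴ = Matrix.diagonal fun i => (ε k i : ℂ) :=
    fun k => by
      rw [Matrix.diagonal_conjTranspose]
      congr 1
      ext i
      simp
  rw [gauge, gauge, ← hN.map_mul' (fun k => Matrix.diagonal fun i => (v k i : ℂ))
    (fun k => Matrix.diagonal fun i => (ε k i : ℂ)) (fun k => by rw [hs, hD])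
    (fun k => by rw [hs, hD])]
  congr 1
  ext k : 1
  rw [Matrix.diagonal_mul_diagonal]
  congr 1
  ext i
  rw [hε2, Complex.ofReal_mul]

/-- The point `u` lies in the box with vertices `±v`, so the convex gauge at `u` is at most its
value at some vertex. All vertices have the gauge of `v`, since sign changes are diagonal unitaries.
-/
theorem gauge_mono (hN : IsBlockUnitarilyInvariant N)
    {u v : Fin p → Fin m → ℝ} (h0 : ∀ k i, 0 ≤ u k i) (h : ∀ k i, u k i ≤ v k i) :
    gauge N u ≤ gauge N v := by
  have hmem : u ∈ convexHull ℝ (Set.univ.pi fun k => Set.univ.pi fun i => {-v k i, v k i}) := by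
    simp only [convexHull_pi, convexHull_pair, Set.mem_pi]
    intro k _ i _
    have hv : 0 ≤ v k i := (h0 k i).trans (h k i)
    rw [segment_eq_Icc (by linarith)]
    exact ⟨by linarith [h0 k i], h k i⟩
  obtain ⟨s, hs, hle⟩ :=
    (convexOn_gauge (N := N)).subset (Set.subset_univ _) (convex_convexHull ℝ _)
    |>.exists_ge_of_mem_convexHull (subset_convexHull ℝ _) hmem
  refine hle.trans_eq (hN.gauge_sign fun k i => ?_)
  simpa using hs k (Set.mem_univ k) i (Set.mem_univ i)

theorem map_cfc_exp (hN : IsBlockUnitarilyInvariant N)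
    (f : ℝ → ℝ) {X : Fin p → Matrix (Fin m) (Fin m) ℂ}
    (hX : ∀ k, (X k).IsHermitian) :
    N (fun k => cfc f (NormedSpace.exp (X k))) =
      gauge N fun k i => f (Real.exp (sortedEig (X k) i)) := by
  choose U hU1 hU2 hU hf using fun k => exists_cfc_eq_conj_diagonal_sortedEig (hX k)
  have e : ∀ k, cfc f (NormedSpace.exp (X k)) =
      U k * (Matrix.diagonal fun i => (f (Real.exp (sortedEig (X k) i)) : ℂ)) * (U k)ᴴ := by
    intro k
    -- On a finite spectrum every function is continuous, so functions compose in the calculus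
    -- without further assumptions on `f`.
    have hfin := Matrix.finite_real_spectrum (A := X k)
    rw [exp_eq_cfc_real_exp (hX k), ← cfc_comp' f Real.exp (X k)
      ((hfin.image _).continuousOn _) (hfin.continuousOn _) (hX k).isSelfAdjoint, hf]
  simp only [e]
  exact hN.map_conj hU1 hU2

theorem map_cfc_abs (hN : IsBlockUnitarilyInvariant N)
    (f : ℝ → ℝ) {F : Fin p → Matrix (Fin m) (Fin m) ℂ} (hF : ∀ k, (F k).det ≠ 0) :
    N (fun k => cfc f (cfc Real.sqrt ((F k)ᴴ * F k))) =
      gauge N fun k i => f (Real.exp (logSingularValues (F k) i)) := by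
  have hX : ∀ k, ((F k)ᴴ * F k).IsHermitian := fun k =>
    Matrix.isHermitian_conjTranspose_mul_self _
  choose U hU1 hU2 hU hf using fun k => exists_cfc_eq_conj_diagonal_sortedEig (hX k)
  have e : ∀ k, cfc f (cfc Real.sqrt ((F k)ᴴ * F k)) = U k *
      (Matrix.diagonal fun i => (f (Real.exp (logSingularValues (F k) i)) : ℂ)) * (U k)ᴴ := by
    intro k
    have hfin := Matrix.finite_real_spectrum (A := (F k)ᴴ * F k)
    rw [← cfc_comp' f Real.sqrt _ ((hfin.image _).continuousOn _) (hfin.continuousOn _)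
      (hX k).isSelfAdjoint, hf]
    congr 3
    ext i
    have hpos := sortedEig_conjTranspose_mul_self_pos (hF k) i
    rw [logSingularValues, ← Real.log_sqrt hpos.le, Real.exp_log (Real.sqrt_pos.2 hpos)]
  simp only [e]
  exact hN.map_conj hU1 hU2

theorem convexOn_gauge_comp (hN : IsBlockUnitarilyInvariant N)
    {g : ℝ → ℝ} (hg0 : ∀ x, 0 ≤ g x) (hg : ConvexOn ℝ Set.univ g) :
    ConvexOn ℝ Set.univ fun y : Fin p → Fin m → ℝ => gauge N fun k i => g (y k i) := by
  refine ⟨convex_univ, fun u _ v _ a b ha hb hab => ?_⟩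
  refine le_trans (hN.gauge_mono (v := a • (fun k i => g (u k i)) + b • fun k i => g (v k i))
    (fun _ _ => hg0 _) fun k i => ?_)
    (convexOn_gauge.2 (Set.mem_univ _) (Set.mem_univ _) ha hb hab)
  exact hg.2 (Set.mem_univ _) (Set.mem_univ _) ha hb hab

/-- Hölder's argument: log-convexity bounds the entries by `f(u)^a f(v)^b`. After division by the
gauges `P` and `Q`, the weighted AM–GM inequality replaces this product by a convex combination,
whose gauge is at most `a + b = 1`. -/
theorem convexOn_log_gauge_comp (hN : IsBlockUnitarilyInvariant N)
    (hN0 : ∀ D, N D = 0 → D = 0) [NeZero m] [NeZero p] {f : ℝ → ℝ}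
    (hf0 : ∀ x, 0 < f x) (hf : ConvexOn ℝ Set.univ fun x => Real.log (f x)) :
    ConvexOn ℝ Set.univ
      fun y : Fin p → Fin m → ℝ => Real.log (gauge N fun k i => f (y k i)) := by
  have hpos : ∀ y : Fin p → Fin m → ℝ, 0 < gauge N fun k i => f (y k i) := fun y =>
    gauge_pos hN0 fun h => (hf0 (y 0 0)).ne' (congrFun (congrFun h 0) 0)
  refine ⟨convex_univ, fun u _ v _ a b ha hb hab => ?_⟩
  set P := gauge N fun k i => f (u k i) with hP
  set Q := gauge N fun k i => f (v k i) with hQ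
  have hPpos : 0 < P := hpos u
  have hQpos : 0 < Q := hpos v
  have hR : 0 < P ^ a * Q ^ b := by positivity
  have hentry : ∀ k i, f ((a • u + b • v) k i) ≤
      ((P ^ a * Q ^ b) • ((a / P) • (fun k i => f (u k i)) + (b / Q) • fun k i => f (v k i))
        : Fin p → Fin m → ℝ) k i := by
    intro k i
    have h1 := hf.2 (Set.mem_univ (u k i)) (Set.mem_univ (v k i)) ha hb hab
    have h2 : f ((a • u + b • v) k i) ≤ f (u k i) ^ a * f (v k i) ^ b := by
      rw [← Real.exp_log (hf0 ((a • u + b • v) k i)), Real.rpow_def_of_pos (hf0 _),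
        Real.rpow_def_of_pos (hf0 _), ← Real.exp_add, Real.exp_le_exp]
      simpa [mul_comm] using h1
    have h3 := Real.geom_mean_le_arith_mean2_weighted ha hb (div_pos (hf0 (u k i)) hPpos).le
      (div_pos (hf0 (v k i)) hQpos).le hab
    rw [Real.div_rpow (hf0 _).le hPpos.le, Real.div_rpow (hf0 _).le hQpos.le, div_mul_div_comm,
      div_le_iff₀ hR] at h3
    refine (h2.trans h3).trans_eq ?_
    simp only [Pi.smul_apply, Pi.add_apply, smul_eq_mul]
    ring
  have h4 := hN.gauge_mono (fun _ _ => (hf0 _).le) hentry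
  have h5 : gauge N ((a / P) • (fun k i => f (u k i)) + (b / Q) • fun k i => f (v k i)) ≤ 1 := by
    refine (gauge_add_le _ _).trans_eq ?_
    rw [gauge_smul, gauge_smul, ← hP, ← hQ, abs_of_nonneg (by positivity),
      abs_of_nonneg (by positivity), div_mul_cancel₀ _ hPpos.ne', div_mul_cancel₀ _ hQpos.ne', hab]
  rw [gauge_smul, abs_of_pos hR] at h4
  have h6 := Real.log_le_log (hpos (a • u + b • v)) (h4.trans (mul_le_of_le_one_right hR.le h5))
  rw [Real.log_mul (by positivity) (by positivity), Real.log_rpow hPpos, Real.log_rpow hQpos] at h6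
  exact h6

end IsBlockUnitarilyInvariant

end Gauge

/-- The multivariate Golden–Thompson inequality for symmetric convex functions of the logarithms of
the singular values. -/
theorem convexOn_sortedEig_le_integral {L : Fin p → List (Matrix (Fin m) (Fin m) ℂ)}
    (hL : ∀ k, ∀ A ∈ L k, A.IsHermitian) {Θ : (Fin p → Fin m → ℝ) → ℝ}
    (hΘ : ConvexOn ℝ Set.univ Θ)
    (hΘs : ∀ (σ : Fin p → Equiv.Perm (Fin m)) v, Θ (fun k i => v k (σ k i)) = Θ v) :
    Integrable (fun t : ℝ =>
      Θ (fun k => logSingularValues (expProd (L k) (1 + Complex.I * t))) * beta0 t) ∧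
    Θ (fun k => sortedEig (L k).sum) ≤ ∫ t : ℝ,
      Θ (fun k => logSingularValues (expProd (L k) (1 + Complex.I * t))) * beta0 t := by
  choose K hK using fun k => exists_abs_logSingularValues_expProd_le (hL k)
  refine convexOn_le_integral_of_majorized hΘ ?_ hΘs
    (y := fun (t : ℝ) k => logSingularValues (expProd (L k) (1 + Complex.I * t)))
    (K := ∑ k, |K k|) (fun k => antitone_sortedEig _) ?_ ?_ ?_ ?_
  · exact continuousOn_univ.1 (hΘ.continuousOn isOpen_univ)
  · exact continuous_pi fun k => continuous_pi fun i =>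
      continuous_logSingularValues_expProd (hL k) i
  · intro t
    have h0 : 0 ≤ ∑ k, |K k| := Finset.sum_nonneg fun _ _ => abs_nonneg _
    refine (pi_norm_le_iff_of_nonneg h0).2 fun k => (pi_norm_le_iff_of_nonneg h0).2 fun i => ?_
    exact ((hK k t i).trans (le_abs_self _)).trans
      (Finset.single_le_sum (f := fun k => |K k|) (fun _ _ => abs_nonneg _) (Finset.mem_univ k))
  · exact fun k j hj => sum_sortedEig_le_integral (hL k) hj
  · exact fun k t => sum_logSingularValues_expProd (hL k) t

end TProd

/-! ### Fourier transform along the third index. -/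

namespace TProd

open Filter Topology MeasureTheory Metric
open scoped Matrix

variable {m p : ℕ} [NeZero p]

/-- The characters of `Fin p`. -/
noncomputable def finChar (k l : Fin p) : ℂ :=
  ZMod.stdAddChar (N := p) (ZMod.finEquiv p k * ZMod.finEquiv p l)

theorem finEquiv_add (k l : Fin p) :
    ZMod.finEquiv p (k + l) = ZMod.finEquiv p k + ZMod.finEquiv p l :=
  map_add (ZMod.finEquiv p) k l

theorem finEquiv_zero : ZMod.finEquiv p 0 = 0 := map_zero (ZMod.finEquiv p)

theorem finChar_add (k l l' : Fin p) : finChar k (l + l') = finChar k l * finChar k l' := by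
  rw [finChar, finEquiv_add, mul_add, AddChar.map_add_eq_mul]
  rfl

theorem finChar_comm (k l : Fin p) : finChar k l = finChar l k := by
  rw [finChar, finChar, mul_comm]

theorem finChar_neg (k l : Fin p) : finChar k (-l) = star (finChar k l) := by
  have h : ZMod.finEquiv p (-l) = -ZMod.finEquiv p l := by
    rw [eq_neg_iff_add_eq_zero, ← finEquiv_add, neg_add_cancel, finEquiv_zero]
  rw [finChar, h, mul_neg, AddChar.map_neg_eq_conj]
  rfl

theorem sum_finChar (l : Fin p) : ∑ k, finChar k l = if l = 0 then (p : ℂ) else 0 := by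
  have h := AddChar.sum_mulShift (ZMod.finEquiv p l) (ZMod.isPrimitive_stdAddChar p)
  rw [← (ZMod.finEquiv p).toEquiv.sum_comp] at h
  have h0 : ZMod.finEquiv p l = 0 ↔ l = 0 := by
    rw [← finEquiv_zero, (ZMod.finEquiv p).injective.eq_iff]
  simp only [h0, ZMod.card] at h
  rw [← Nat.cast_zero (R := ℂ), ← Nat.cast_ite] 
  exact h

/-- The inverse Fourier transform along the third index. -/
noncomputable def invFourier : (Fin p → Matrix (Fin m) (Fin m) ℂ) →ₗ[ℂ] Tensor ℂ m m p where
  toFun D := fun a => (p : ℂ)⁻¹ • ∑ k, finChar k a • D k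
  map_add' D D' := by
    ext a : 1
    simp [Finset.sum_add_distrib]
  map_smul' c D := by
    ext a : 1
    simp [Finset.smul_sum, smul_comm c]

theorem bcirc_invFourier_apply (D : Fin p → Matrix (Fin m) (Fin m) ℂ) (x y : Fin p × Fin m) :
    bcirc (invFourier D) x y = (p : ℂ)⁻¹ * ∑ k, finChar k (x.1 - y.1) * D k x.2 y.2 := by
  simp [bcirc, invFourier, Matrix.sum_apply]

theorem invFourier_surjective : Function.Surjective (invFourier (m := m) (p := p)) := by
  intro C
  refine ⟨fun k => ∑ a, finChar k (-a) • C a, ?_⟩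
  ext b i j
  have hp : (p : ℂ) ≠ 0 := Nat.cast_ne_zero.2 (NeZero.ne p)
  have h : ∀ a, ∑ k, finChar k b * finChar k (-a) = if b = a then (p : ℂ) else 0 := fun a => by
    simp only [← finChar_add, sum_finChar, ← sub_eq_add_neg, sub_eq_zero]
  have e : invFourier (fun k => ∑ a, finChar k (-a) • C a) b i j =
      (p : ℂ)⁻¹ * ∑ k, finChar k b * ∑ a, finChar k (-a) * C a i j := by
    simp [invFourier, Matrix.sum_apply]
  rw [e]
  simp only [Finset.mul_sum]
  rw [Finset.sum_comm]
  have e2 : ∀ a, ∑ k, (p : ℂ)⁻¹ * (finChar k b * (finChar k (-a) * C a i j)) =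
      (p : ℂ)⁻¹ * (∑ k, finChar k b * finChar k (-a)) * C a i j := fun a => by
    rw [Finset.mul_sum, Finset.sum_mul]
    exact Finset.sum_congr rfl fun k _ => by ring
  simp only [e2, h]
  simp [hp]

/-- Source and target are the same finite-dimensional space, so surjectivity suffices. -/
theorem invFourier_injective : Function.Injective (invFourier (m := m) (p := p)) :=
  LinearMap.injective_iff_surjective.2 invFourier_surjective

/-- The convolution theorem: multiplying block circulants convolves the slices, and orthogonality of
characters leaves only the terms with equal frequencies. -/
theorem bcirc_invFourier_mul (D D' : Fin p → Matrix (Fin m) (Fin m) ℂ) :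
    bcirc (invFourier (D * D')) = bcirc (invFourier D) * bcirc (invFourier D') := by
  ext x y
  have hp : (p : ℂ) ≠ 0 := Nat.cast_ne_zero.2 (NeZero.ne p)
  have h : ∀ k k' : Fin p, ∑ b, finChar k (x.1 - b) * finChar k' (b - y.1) =
      if k' = k then (p : ℂ) * finChar k (x.1 - y.1) else 0 := fun k k' => by
    have e : ∀ b, finChar k (x.1 - b) * finChar k' (b - y.1) =
        finChar k x.1 * finChar k' (-y.1) * finChar b (k' - k) := fun b => by
      rw [sub_eq_add_neg, sub_eq_add_neg, sub_eq_add_neg, finChar_add, finChar_add, finChar_add,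
        finChar_neg k b, finChar_neg b k, finChar_comm b k, finChar_comm b k']
      ring
    simp only [e, ← Finset.mul_sum, sum_finChar, sub_eq_zero]
    split_ifs with hk
    · rw [hk, sub_eq_add_neg x.1, finChar_add]
      ring
    · simp
  symm
  calc (bcirc (invFourier D) * bcirc (invFourier D')) x y
      = ∑ b, ∑ j, ∑ k, ∑ k', (p : ℂ)⁻¹ * (p : ℂ)⁻¹ *
          (finChar k (x.1 - b) * finChar k' (b - y.1)) * (D k x.2 j * D' k' j y.2) := by
        rw [Matrix.mul_apply, Fintype.sum_prod_type]
        refine Finset.sum_congr rfl fun b _ => Finset.sum_congr rfl fun j _ => ?_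
        rw [bcirc_invFourier_apply, bcirc_invFourier_apply, mul_mul_mul_comm, Finset.sum_mul_sum]
        simp only [Finset.mul_sum]
        exact Finset.sum_congr rfl fun k _ => Finset.sum_congr rfl fun k' _ => by ring
    _ = ∑ j, ∑ k, ∑ k', ∑ b, (p : ℂ)⁻¹ * (p : ℂ)⁻¹ *
          (finChar k (x.1 - b) * finChar k' (b - y.1)) * (D k x.2 j * D' k' j y.2) := by
        rw [Finset.sum_comm]
        refine Finset.sum_congr rfl fun j _ => ?_
        rw [Finset.sum_comm]
        exact Finset.sum_congr rfl fun k _ => Finset.sum_comm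
    _ = ∑ j, ∑ k, (p : ℂ)⁻¹ * (finChar k (x.1 - y.1) * (D k x.2 j * D' k j y.2)) := by
        refine Finset.sum_congr rfl fun j _ => Finset.sum_congr rfl fun k _ => ?_
        simp only [← Finset.sum_mul, ← Finset.mul_sum, h]
        rw [Finset.sum_eq_single k]
        · rw [if_pos rfl]
          field_simp
        · intro k' _ hk'
          rw [if_neg hk', mul_zero, zero_mul]
        · simp
    _ = bcirc (invFourier (D * D')) x y := by
        rw [bcirc_invFourier_apply, Finset.sum_comm, Finset.mul_sum]
        refine Finset.sum_congr rfl fun k _ => ?_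
        rw [Pi.mul_apply, Matrix.mul_apply, Finset.mul_sum, Finset.mul_sum]

theorem bcirc_invFourier_one :
    bcirc (invFourier (1 : Fin p → Matrix (Fin m) (Fin m) ℂ)) = 1 := by
  ext x y
  have hp : (p : ℂ) ≠ 0 := Nat.cast_ne_zero.2 (NeZero.ne p)
  rw [bcirc_invFourier_apply]
  simp only [Pi.one_apply, ← Finset.sum_mul, sum_finChar, sub_eq_zero, Matrix.one_apply,
    Prod.ext_iff]
  by_cases h1 : x.1 = y.1 <;> by_cases h2 : x.2 = y.2 <;> simp [h1, h2, hp]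

theorem bcirc_invFourier_star (D : Fin p → Matrix (Fin m) (Fin m) ℂ) :
    bcirc (invFourier (star D)) = (bcirc (invFourier D))ᴴ := by
  ext x y
  rw [Matrix.conjTranspose_apply, bcirc_invFourier_apply, bcirc_invFourier_apply, star_mul',
    star_sum, star_inv₀, star_natCast]
  congr 1
  refine Finset.sum_congr rfl fun k _ => ?_
  rw [star_mul', ← finChar_neg, neg_sub]
  rfl

/-- The embedding of `M_m(ℂ)^p` as the algebra of block circulant matrices. -/
noncomputable def blockCirculantHom :
    (Fin p → Matrix (Fin m) (Fin m) ℂ) →⋆ₐ[ℂ] Matrix (Fin p × Fin m) (Fin p × Fin m) ℂ where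
  toFun D := bcirc (invFourier D)
  map_one' := bcirc_invFourier_one
  map_mul' := bcirc_invFourier_mul
  map_zero' := by rw [map_zero]; rfl
  map_add' D D' := by rw [map_add]; rfl
  commutes' c := by
    rw [Algebra.algebraMap_eq_smul_one, Algebra.algebraMap_eq_smul_one, map_smul,
      ← bcirc_invFourier_one]
    rfl
  map_star' := bcirc_invFourier_star

theorem blockCirculantHom_apply (D : Fin p → Matrix (Fin m) (Fin m) ℂ) :
    blockCirculantHom D = bcirc (invFourier D) := rfl

theorem bcircInv_blockCirculantHom (D : Fin p → Matrix (Fin m) (Fin m) ℂ) :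
    bcircInv (blockCirculantHom D) = invFourier D := bcircInv_bcirc _

theorem blockCirculantHom_injective : Function.Injective (blockCirculantHom (m := m) (p := p)) :=
  fun D D' h => invFourier_injective <| by
    rw [← bcircInv_blockCirculantHom, h, bcircInv_blockCirculantHom]

/-- One polynomial interpolates `f` on the union of all the finite spectra involved, and polynomials
commute with algebra homomorphisms. -/
theorem cfc_blockCirculantHom (f : ℝ → ℝ) {D : Fin p → Matrix (Fin m) (Fin m) ℂ}
    (hD : ∀ k, (D k).IsHermitian) :
    cfc f (blockCirculantHom D) = blockCirculantHom fun k => cfc f (D k) := by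
  have hΨ : IsSelfAdjoint (blockCirculantHom D) := by
    rw [isSelfAdjoint_iff, ← map_star]
    congr 1
    ext k : 1
    exact hD k
  have hfin : (spectrum ℝ (blockCirculantHom D) ∪ ⋃ k, spectrum ℝ (D k)).Finite :=
    Matrix.finite_real_spectrum.union (Set.finite_iUnion fun k => Matrix.finite_real_spectrum)
  set q : Polynomial ℝ := Lagrange.interpolate hfin.toFinset id f with hq
  have heq : ∀ x ∈ spectrum ℝ (blockCirculantHom D) ∪ ⋃ k, spectrum ℝ (D k), f x = q.eval x :=
    fun x hx => (Lagrange.eval_interpolate_at_node f Function.injective_id.injOn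
      (hfin.mem_toFinset.2 hx)).symm
  have hk : ∀ k, cfc f (D k) = Polynomial.aeval D q k := fun k => by
    rw [cfc_congr fun x hx => heq x (Or.inr (Set.mem_iUnion.2 ⟨k, hx⟩)),
      cfc_polynomial q (D k) (hD k).isSelfAdjoint]
    exact Polynomial.aeval_algHom_apply (Pi.evalAlgHom ℝ (fun _ => Matrix (Fin m) (Fin m) ℂ) k) D q
  rw [cfc_congr fun x hx => heq x (Or.inl hx), cfc_polynomial q _ hΨ, funext hk]
  exact Polynomial.aeval_algHom_apply
    ((blockCirculantHom (m := m) (p := p)).toAlgHom.restrictScalars ℝ) D q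

theorem continuous_blockCirculantHom : Continuous (blockCirculantHom (m := m) (p := p)) :=
  (blockCirculantHom (m := m) (p := p)).toAlgHom.toLinearMap.continuous_of_finiteDimensional

open scoped Matrix.Norms.Operator in
theorem exp_blockCirculantHom (D : Fin p → Matrix (Fin m) (Fin m) ℂ) :
    NormedSpace.exp (blockCirculantHom D) = blockCirculantHom fun k => NormedSpace.exp (D k) := by
  have h := NormedSpace.map_exp (blockCirculantHom (m := m) (p := p))
    continuous_blockCirculantHom D
  rw [Pi.exp_def] at h
  exact h.symm

end TProd

/-! ### Transfer of the tensor operations to blocks, and the theorem. -/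

namespace TProd

open Filter Topology MeasureTheory Metric
open scoped Matrix

variable {m p : ℕ} [NeZero p]

theorem tmul_eq_bcircInv (C D : Tensor ℂ m m p) : tmul C D = bcircInv (bcirc C * bcirc D) := by
  ext k a b
  simp [tmul, fold, unfold, bcircInv, bcirc, Matrix.mul_apply]

theorem tmul_invFourier (D D' : Fin p → Matrix (Fin m) (Fin m) ℂ) :
    tmul (invFourier D) (invFourier D') = invFourier (D * D') := by
  rw [tmul_eq_bcircInv, ← bcirc_invFourier_mul, bcircInv_bcirc]

theorem tone_eq_invFourier : (tone : Tensor ℂ m m p) = invFourier 1 := by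
  rw [tone, ← bcirc_invFourier_one, bcircInv_bcirc]

theorem tconj_invFourier (D : Fin p → Matrix (Fin m) (Fin m) ℂ) :
    tconj (invFourier D) = invFourier (star D) := by
  rw [tconj, ← bcirc_invFourier_star, bcircInv_bcirc]

theorem tfun_invFourier (f : ℝ → ℝ) {D : Fin p → Matrix (Fin m) (Fin m) ℂ}
    (hD : ∀ k, (D k).IsHermitian) :
    tfun f (invFourier D) = invFourier fun k => cfc f (D k) := by
  rw [tfun, ← blockCirculantHom_apply, cfc_blockCirculantHom f hD, bcircInv_blockCirculantHom]

theorem texp_invFourier (D : Fin p → Matrix (Fin m) (Fin m) ℂ) :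
    texp (invFourier D) = invFourier fun k => NormedSpace.exp (D k) := by
  rw [texp, ← blockCirculantHom_apply, exp_blockCirculantHom, bcircInv_blockCirculantHom]

theorem tabs_invFourier (F : Fin p → Matrix (Fin m) (Fin m) ℂ) :
    tabs (invFourier F) = invFourier fun k => cfc Real.sqrt ((F k)ᴴ * F k) := by
  rw [tabs, tconj_invFourier, tmul_invFourier]
  exact tfun_invFourier _ fun k => Matrix.isHermitian_conjTranspose_mul_self (F k)

theorem tprod_invFourier {n : ℕ} (D : Fin n → Fin p → Matrix (Fin m) (Fin m) ℂ) :
    tprod (fun i => invFourier (D i)) = invFourier fun k => (List.ofFn fun i => D i k).prod := by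
  have key : ∀ l : List (Fin p → Matrix (Fin m) (Fin m) ℂ),
      (l.map invFourier).foldr tmul tone = invFourier l.prod := fun l => by
    induction l with
    | nil => simpa using tone_eq_invFourier
    | cons D l ih => rw [List.map_cons, List.foldr_cons, ih, tmul_invFourier, List.prod_cons]
  have h := key (List.ofFn D)
  rw [List.map_ofFn] at h
  rw [tprod]
  refine h.trans (congrArg _ (funext fun k => ?_))
  have h2 := map_list_prod (Pi.evalMonoidHom (fun _ => Matrix (Fin m) (Fin m) ℂ) k) (List.ofFn D)
  rw [List.map_ofFn] at h2
  exact h2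

theorem isUnitary_invFourier {U : Fin p → Matrix (Fin m) (Fin m) ℂ} (h1 : ∀ k, (U k)ᴴ * U k = 1)
    (h2 : ∀ k, U k * (U k)ᴴ = 1) : IsUnitary (invFourier U) := by
  rw [IsUnitary, tconj_invFourier, tmul_invFourier, tmul_invFourier, tone_eq_invFourier]
  exact ⟨congrArg _ (funext h1), congrArg _ (funext h2)⟩

/-- The real functional calculus always yields a self-adjoint matrix, and injectivity of the star
homomorphism carries self-adjointness back to the blocks. -/
theorem exists_tlog_eq_invFourier (C : Tensor ℂ m m p) :
    ∃ A : Fin p → Matrix (Fin m) (Fin m) ℂ, (∀ k, (A k).IsHermitian) ∧ tlog C = invFourier A := by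
  obtain ⟨A, hA⟩ := invFourier_surjective (tlog C)
  refine ⟨A, fun k => ?_, hA.symm⟩
  have h : blockCirculantHom (star A) = blockCirculantHom A := by
    rw [map_star, blockCirculantHom_apply, hA, tlog, bcirc_tfun]
    exact IsSelfAdjoint.cfc
  exact congrFun (blockCirculantHom_injective h) k

theorem tcpow_eq_invFourier {C : Tensor ℂ m m p} {A : Fin p → Matrix (Fin m) (Fin m) ℂ}
    (hA : tlog C = invFourier A) (z : ℂ) :
    tcpow C z = invFourier fun k => NormedSpace.exp (z • A k) := by
  rw [tcpow, hA, ← map_smul, texp_invFourier]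
  rfl

/-- A unitarily invariant norm on tensors, read on `M_m(ℂ)^p` through the Fourier transform. -/
noncomputable def UnitarilyInvariantNorm.fourier (N : UnitarilyInvariantNorm m p) :
    Seminorm ℂ (Fin p → Matrix (Fin m) (Fin m) ℂ) :=
  N.toSeminorm.comp invFourier

theorem UnitarilyInvariantNorm.isBlockUnitarilyInvariant_fourier
    (N : UnitarilyInvariantNorm m p) : IsBlockUnitarilyInvariant N.fourier where
  map_mul D U h1 h2 := by
    have h := N.map_mul_unitary' (invFourier D) _ (isUnitary_invFourier h1 h2)
    rw [tmul_invFourier] at h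
    exact h
  map_mul' D U h1 h2 := by
    have h := N.map_unitary_mul' (invFourier D) _ (isUnitary_invFourier h1 h2)
    rw [tmul_invFourier] at h
    exact h

theorem UnitarilyInvariantNorm.eq_zero_of_fourier_eq_zero (N : UnitarilyInvariantNorm m p)
    (D : Fin p → Matrix (Fin m) (Fin m) ℂ) (h : N.fourier D = 0) : D = 0 :=
  invFourier_injective ((N.eq_zero_of_map_eq_zero' _ h).trans (map_zero _).symm)

/-- Both sides of the inequality, in terms of the gauge function of the norm. -/
theorem exists_map_tfun_eq_gauge {n : ℕ} (N : UnitarilyInvariantNorm m p)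
    (C : Fin n → Tensor ℂ m m p) :
    ∃ L : Fin p → List (Matrix (Fin m) (Fin m) ℂ), (∀ k, ∀ A ∈ L k, A.IsHermitian) ∧
      (∀ f : ℝ → ℝ, N (tfun f (texp (∑ i, tlog (C i)))) =
        gauge N.fourier fun k i => f (Real.exp (sortedEig (L k).sum i))) ∧
      ∀ (f : ℝ → ℝ) (z : ℂ), N (tfun f (tabs (tprod fun i => tcpow (C i) z))) =
        gauge N.fourier fun k i => f (Real.exp (logSingularValues (expProd (L k) z) i)) := by
  choose A hA hlog using fun i => exists_tlog_eq_invFourier (C i)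
  have hL : ∀ k, ∀ B ∈ List.ofFn (fun i => A i k), B.IsHermitian := by
    intro k B hB
    obtain ⟨i, rfl⟩ := (List.mem_ofFn' _ _).1 hB
    exact hA i k
  refine ⟨fun k => List.ofFn fun i => A i k, hL, fun f => ?_, fun f z => ?_⟩
  · have hX : ∀ k, (List.ofFn fun i => A i k).sum.IsHermitian := fun k =>
      isHermitian_list_sum (hL k)
    rw [← N.isBlockUnitarilyInvariant_fourier.map_cfc_exp f hX]
    have e : ∑ i, tlog (C i) = invFourier fun k => (List.ofFn fun i => A i k).sum := by
      simp only [hlog, ← map_sum]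
      congr 1
      ext k : 1
      rw [List.sum_ofFn, Finset.sum_apply]
    rw [e, texp_invFourier, tfun_invFourier f fun k => (hX k).exp]
    rfl
  · have e : tprod (fun i => tcpow (C i) z) =
        invFourier fun k => expProd (List.ofFn fun i => A i k) z := by
      simp only [tcpow_eq_invFourier (hlog _), tprod_invFourier, expProd, List.map_ofFn,
        Function.comp_def]
    rw [← N.isBlockUnitarilyInvariant_fourier.map_cfc_abs f fun k => det_expProd_ne_zero (hL k) z,
      e, tabs_invFourier, tfun_invFourier f fun k => IsSelfAdjoint.cfc]
    rfl

theorem elog_of_pos {x : ℝ} (hx : 0 < x) : elog x = (Real.log x : EReal) :=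
  ENNReal.log_ofReal_of_pos hx

theorem elog_zero : elog 0 = ⊥ := by simp [elog]

/-- A continuous function whose logarithm is convex in the extended sense vanishes identically as
soon as it vanishes somewhere. -/
theorem eq_zero_of_isConvexEReal_elog {ψ : ℝ → ℝ} (hc : Continuous ψ) (h0 : ∀ x, 0 ≤ ψ x)
    (hψ : IsConvexEReal fun x => elog (ψ x)) {x₀ : ℝ} (hx₀ : ψ x₀ = 0) (y : ℝ) : ψ y = 0 := by
  -- The value `-∞` at `x₀` forces `-∞` on the open segment towards `y`; continuity of `ψ` reaches
  -- the endpoint `y`.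
  have key : ∀ a ∈ Set.Ioo (0 : ℝ) 1, ψ (a * x₀ + (1 - a) * y) = 0 := by
    intro a ha
    by_contra hne
    have h := hψ x₀ y a (1 - a) ha.1 (by linarith [ha.2]) (by ring)
    simp only [hx₀, elog_zero, EReal.coe_mul_bot_of_pos ha.1, EReal.bot_add] at h
    rw [elog_of_pos (lt_of_le_of_ne (h0 _) (Ne.symm hne))] at h
    exact absurd (le_bot_iff.1 h) (EReal.coe_ne_bot _)
  have hlim : Tendsto (fun a : ℝ => ψ (a * x₀ + (1 - a) * y)) (𝓝[>] 0) (𝓝 (ψ y)) := by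
    have : Continuous fun a : ℝ => ψ (a * x₀ + (1 - a) * y) := by fun_prop
    simpa using (this.tendsto 0).mono_left nhdsWithin_le_nhds
  refine tendsto_nhds_unique hlim (tendsto_const_nhds.congr' ?_)
  filter_upwards [Ioo_mem_nhdsGT (zero_lt_one : (0 : ℝ) < 1)] with a ha
  exact (key a ha).symm

theorem convexOn_log_of_isConvexEReal_elog {ψ : ℝ → ℝ} (h0 : ∀ x, 0 < ψ x)
    (hψ : IsConvexEReal fun x => elog (ψ x)) : ConvexOn ℝ Set.univ fun x => Real.log (ψ x) := by
  refine convexOn_iff_forall_pos.2 ⟨convex_univ, fun x _ y _ a b ha hb hab => ?_⟩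
  have h := hψ x y a b ha hb hab
  simp only [elog_of_pos (h0 _)] at h
  exact_mod_cast h

theorem eintegral_coe {F : ℝ → ℝ} (hF : Integrable F) :
    eintegral (fun t => (F t : EReal)) = ((∫ t, F t : ℝ) : EReal) := by
  have h1 := hF.lintegral_lt_top
  have h2 := hF.neg.lintegral_lt_top
  simp only [Pi.neg_apply] at h2
  rw [integral_eq_lintegral_pos_part_sub_lintegral_neg_part hF, eintegral]
  simp only [← EReal.coe_neg, EReal.toENNReal_of_ne_top (EReal.coe_ne_top _), EReal.toReal_coe]
  rw [EReal.coe_sub, EReal.coe_ennreal_toReal h1.ne, EReal.coe_ennreal_toReal h2.ne]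

end TProd

theorem mainTheorem4 {m p n : ℕ} [NeZero p] (N : TProd.UnitarilyInvariantNorm m p)
    (C : Fin n → TProd.Tensor ℝ m m p) (hC : ∀ i, TProd.IsTPD (C i)) :
    (∀ f : ℝ → ℝ, ContinuousOn f (Set.Ioi 0) → (∀ x, 0 < x → 0 ≤ f x) →
      TProd.IsConvexEReal (fun x => TProd.elog (f (Real.exp x))) →
      MeasureTheory.Integrable (fun t : ℝ => Real.log (N (TProd.tfun f (TProd.tabs (TProd.tprod
          fun i => TProd.tcpow (TProd.toComplex (C i)) (1 + Complex.I * t))))) * TProd.beta0 t) ∧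
      ENNReal.ofReal
          (N (TProd.tfun f (TProd.texp (∑ i, TProd.tlog (TProd.toComplex (C i)))))) ≤
        EReal.exp (TProd.eintegral fun t : ℝ =>
          TProd.elog (N (TProd.tfun f (TProd.tabs (TProd.tprod
            fun i => TProd.tcpow (TProd.toComplex (C i)) (1 + Complex.I * t))))) *
          (TProd.beta0 t : EReal))) ∧
    (∀ g : ℝ → ℝ, ContinuousOn g (Set.Ioi 0) → (∀ x, 0 < x → 0 ≤ g x) →
      ConvexOn ℝ Set.univ (fun x => g (Real.exp x)) →
      MeasureTheory.Integrable (fun t : ℝ => N (TProd.tfun g (TProd.tabs (TProd.tprod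
          fun i => TProd.tcpow (TProd.toComplex (C i)) (1 + Complex.I * t)))) * TProd.beta0 t) ∧
      N (TProd.tfun g (TProd.texp (∑ i, TProd.tlog (TProd.toComplex (C i))))) ≤
        ∫ t : ℝ, N (TProd.tfun g (TProd.tabs (TProd.tprod
            fun i => TProd.tcpow (TProd.toComplex (C i)) (1 + Complex.I * t)))) *
          TProd.beta0 t) := by
  obtain ⟨L, hL, hleft, hright⟩ :=
    TProd.exists_map_tfun_eq_gauge N fun i => TProd.toComplex (C i)
  have hN := N.isBlockUnitarilyInvariant_fourier
  simp only [hleft, hright]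
  refine ⟨fun f hfc hf0 hf => ?_, fun g _ hg0 hg => ?_⟩
  · have hψc : Continuous fun x => f (Real.exp x) :=
      hfc.comp_continuous Real.continuous_exp Real.exp_pos
    -- In the degenerate case all norms vanish: the real integrand is `0` because `Real.log 0 = 0`,
    -- and the left-hand side is `0`. Otherwise a single zero of `f ∘ exp` would make it vanish
    -- identically, so `f ∘ exp` is positive and real logarithms suffice.
    by_cases hdeg : m = 0 ∨ ∀ x, f (Real.exp x) = 0
    · simp only [TProd.gauge_comp_eq_zero (ψ := fun x => f (Real.exp x)) hdeg]
      simp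
    · push Not at hdeg
      obtain ⟨hm, x₁, hx₁⟩ := hdeg
      have : NeZero m := ⟨hm⟩
      have hpos : ∀ x, 0 < f (Real.exp x) := fun x =>
        lt_of_le_of_ne (hf0 _ (Real.exp_pos x)) fun h0 => hx₁ <|
          TProd.eq_zero_of_isConvexEReal_elog hψc (fun x => hf0 _ (Real.exp_pos x)) hf h0.symm x₁
      have hgpos : ∀ v : Fin p → Fin m → ℝ,
          0 < TProd.gauge N.fourier fun k i => f (Real.exp (v k i)) := fun v =>
        TProd.gauge_pos N.eq_zero_of_fourier_eq_zero fun h =>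
          (hpos (v 0 0)).ne' (congrFun (congrFun h 0) 0)
      obtain ⟨hint, hle⟩ := TProd.convexOn_sortedEig_le_integral hL
        (hN.convexOn_log_gauge_comp N.eq_zero_of_fourier_eq_zero hpos
          (TProd.convexOn_log_of_isConvexEReal_elog hpos hf))
        fun σ v => congrArg Real.log (hN.gauge_comp_perm σ fun k i => f (Real.exp (v k i)))
      refine ⟨hint, ?_⟩
      simp only [TProd.elog_of_pos (hgpos _), ← EReal.coe_mul]
      rw [TProd.eintegral_coe hint, EReal.exp_coe]
      exact ENNReal.ofReal_le_ofReal ((Real.le_exp_log _).trans (Real.exp_le_exp.2 hle))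
  · exact TProd.convexOn_sortedEig_le_integral hL
      (hN.convexOn_gauge_comp (fun x => hg0 _ (Real.exp_pos x)) hg)
      fun σ v => hN.gauge_comp_perm σ fun k i => g (Real.exp (v k i))
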